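/- Let $A$ and $B$ be finite-dimensional quantum systems, each with a fixed orthonormal (incoherent) basis; composite systems carry the product basis, and $\Delta$ denotes the dephasing channel in the incoherent basis, i.e. the map that deletes the off-diagonal entries. Ancillary systems $\widetilde A,\widetilde B$ are finite-dimensional of arbitrary dimension, with a fixed incoherent basis, and identity channels on systems that are not acted on are omitted. A measurement is a POVM $\mathcal M=\{M_x\}$ with any finite number of outcomes, and $\mathcal M\circ\mathcal E$ is the POVM $\{\mathcal E^\dagger(M_x)\}$. It is incoherent, $\mathcal M\in\mathbf{IM}$, if $\Delta(M_x)=M_x$ for all $x$. A quantum channel $\mathcal F$ (with equal input and output system) is detection-incoherent, $\mathcal F\in\mathbf{DIO}$, if $\Delta\circ\mathcal F=\Delta\circ\mathcal F\circ\Delta$; it is unital if $\mathcal F(I)=I$. LOCC channels for a bipartition $X{:}Y$ are the finite compositions of one-way LOCC channels (in either direction), an LOCC measurement is an LOCC channel followed by local measurements, the outcome being a function of the local outcomes, and $\overline{\mathbf{LOCC}}(X{:}Y)$ and $\overline{\mathbf{LOCC}}_{\mathrm m}(X{:}Y)$ are the closures of the sets of LOCC channels and LOCC measurements. For two measurements on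 a system of dimension $D_0$ with the same outcomes, $D_m(\mathcal M\Vert\mathcal N)=\frac1{D_0}\sum_x D(M_x\Vert N_x)$, where $D(P\Vert Q)=\operatorname{tr}P(\log P-\log Q)$ if $\ker Q\subseteq\ker P$ and $D(P\Vert Q)=+\infty$ otherwise. The measurement-cohering power of a channel $\mathcal E_A$ on $A$ and the measurement-entangling power of a channel $\mathcal G_{AB}$ on $AB$ are $$C(\mathcal E_A)=\inf_{\mathcal F_A\in\mathbf{DIO}}\ \sup_{\widetilde A,\ \mathcal M\in\mathbf{IM}(A\widetilde A)} D_m(\mathcal M\circ\mathcal E_A\Vert\mathcal M\circ\mathcal F_A),$$ $$E(\mathcal G_{AB})=\inf_{\mathcal F_{AB}\in\overline{\mathbf{LOCC}}(A:B)}\ \sup_{\widetilde A,\widetilde B,\ \mathcal M\in\overline{\mathbf{LOCC}}_{\mathrm m}(A\widetilde A:B\widetilde B)} D_m(\mathcal M\circ\mathcal G_{AB}\Vert\mathcal M\circ\mathcal F_{AB}).$$ Theorem. For every quantum channel $\mathcal E_A$ on $A$, every detection-incoherent channel $\mathcal K_{AB}$ on $AB$ and every unital detection-incoherent channel $\mathcal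 L_{AB}$ on $AB$, $$E(\Delta_{AB}\circ\mathcal K_{AB}\circ\mathcal E_A\circ\mathcal L_{AB})\le C(\mathcal E_A),$$ where $\mathcal E_A$ stands for $\mathcal E_A\otimes\mathsf{id}_B$ in the composition. -/

import Mathlib

open scoped Kronecker Topology ComplexOrder

noncomputable section

namespace QMeas

/-- Operators on the Hilbert space whose incoherent (reference) orthonormal basis is labelled by
the finite set `A`, written as matrices in that basis. -/
abbrev Op (A : Type) : Type := Matrix A A ℂ

/-- Linear maps ("superoperators") from operators on `A` to operators on `C`. -/
abbrev SOp (A C : Type) : Type := Op A →ₗ[ℂ] Op C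

/-! ### Tensor products, adjoints, quantum channels -/

/-- `Φ ⊗ id_B`, acting on block matrices. -/
def ampL {A C : Type} (B : Type) (Φ : SOp A C) : SOp (A × B) (C × B) where
  toFun X := Matrix.of fun p q => Φ (Matrix.of fun i k => X (i, p.2) (k, q.2)) p.1 q.1
  map_add' X Y := by
    ext p q
    exact congrFun (congrFun (Φ.map_add (Matrix.of fun i k => X (i, p.2) (k, q.2))
      (Matrix.of fun i k => Y (i, p.2) (k, q.2))) p.1) q.1
  map_smul' c X := by
    ext p q
    exact congrFun (congrFun (Φ.map_smul c (Matrix.of fun i k => X (i, p.2) (k, q.2))) p.1) q.1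

/-- `id_A ⊗ Ψ`, acting on block matrices. -/
def ampR {B D : Type} (A : Type) (Ψ : SOp B D) : SOp (A × B) (A × D) where
  toFun X := Matrix.of fun p q => Ψ (Matrix.of fun j l => X (p.1, j) (q.1, l)) p.2 q.2
  map_add' X Y := by
    ext p q
    exact congrFun (congrFun (Ψ.map_add (Matrix.of fun j l => X (p.1, j) (q.1, l))
      (Matrix.of fun j l => Y (p.1, j) (q.1, l))) p.2) q.2
  map_smul' c X := by
    ext p q
    exact congrFun (congrFun (Ψ.map_smul c (Matrix.of fun j l => X (p.1, j) (q.1, l))) p.2) q.2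

/-- The tensor product `Φ ⊗ Ψ` of superoperators. -/
def tensor {A B C D : Type} (Φ : SOp A C) (Ψ : SOp B D) : SOp (A × B) (C × D) :=
  ampL D Φ ∘ₗ ampR A Ψ

theorem tensor_kronecker {A B C D : Type} (Φ : SOp A C) (Ψ : SOp B D) (X : Op A) (Y : Op B) :
    tensor Φ Ψ (X ⊗ₖ Y) = Φ X ⊗ₖ Ψ Y := by
  ext p q
  have h1 : ∀ i k : A, (Matrix.of fun j l => (X ⊗ₖ Y) (i, j) (k, l)) = X i k • Y := by
    intro i k; ext j l; rfl
  have h2 : (Matrix.of fun i k => (X i k • Ψ Y) p.2 q.2) = (Ψ Y p.2 q.2) • X := by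
    ext i k; simp [mul_comm]
  simp only [tensor, ampL, ampR, LinearMap.comp_apply, LinearMap.coe_mk, AddHom.coe_mk,
    Matrix.of_apply, h1, map_smul]
  rw [h2, map_smul]
  simp [mul_comm]

/-- The adjoint (Heisenberg picture) of `Φ`, determined by `tr (Φ† Y * X) = tr (Y * Φ X)`. -/
def dual {A C : Type} [DecidableEq A] [Fintype C] (Φ : SOp A C) (Y : Op C) : Op A :=
  Matrix.of fun i j => (Y * Φ (Matrix.single j i 1)).trace

theorem trace_dual_mul {A C : Type} [Fintype A] [DecidableEq A] [Fintype C]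
    (Φ : SOp A C) (Y : Op C) (X : Op A) : (dual Φ Y * X).trace = (Y * Φ X).trace := by
  conv_rhs => rw [Matrix.matrix_eq_sum_single X]
  have h : ∀ i j, Matrix.single i j (X i j) = X i j • Matrix.single i j (1 : ℂ) := by
    intro i j; simp [Matrix.smul_single]
  simp only [h, map_sum, map_smul, Matrix.mul_sum, Matrix.trace_sum, Matrix.mul_smul,
    Matrix.trace_smul, smul_eq_mul]
  rw [Finset.sum_comm]
  simp [Matrix.trace, Matrix.mul_apply, dual, mul_comm]

/-- Complete positivity: `Φ ⊗ id` is positive for every finite-dimensional ancilla. -/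
def IsCP {A C : Type} (Φ : SOp A C) : Prop :=
  ∀ (k : ℕ) (X : Op (A × Fin k)), X.PosSemidef → (ampL (Fin k) Φ X).PosSemidef

/-- Trace preservation. -/
def IsTP {A C : Type} [Fintype A] [Fintype C] (Φ : SOp A C) : Prop :=
  ∀ X : Op A, (Φ X).trace = X.trace

/-- Quantum channels: completely positive trace-preserving maps. -/
def IsChannel {A C : Type} [Fintype A] [Fintype C] (Φ : SOp A C) : Prop :=
  IsCP Φ ∧ IsTP Φ

/-- Unital maps. -/
def IsUnital {A C : Type} [DecidableEq A] [DecidableEq C] (Φ : SOp A C) : Prop :=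
  Φ 1 = 1

/-- The bipartite channel `Φ_{AB}` extended by the identity on ancillas `A'` and `B'`, with the
systems grouped as `(A A') : (B B')`. -/
def extend {A B : Type} (A' B' : Type) (Φ : SOp (A × B) (A × B)) :
    SOp ((A × A') × (B × B')) ((A × A') × (B × B')) :=
  (Matrix.reindexLinearEquiv ℂ ℂ (Equiv.prodProdProdComm A B A' B')
      (Equiv.prodProdProdComm A B A' B')).toLinearMap
    ∘ₗ ampL (A' × B') Φ
    ∘ₗ (Matrix.reindexLinearEquiv ℂ ℂ (Equiv.prodProdProdComm A A' B B')
      (Equiv.prodProdProdComm A A' B B')).toLinearMap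

/-! ### Measurements and their relative entropy -/

/-- Positive operator valued measures with finite outcome set `ι`. -/
def IsPOVM {A ι : Type} [DecidableEq A] [Fintype ι] (M : ι → Op A) : Prop :=
  (∀ x, (M x).PosSemidef) ∧ ∑ x, M x = 1

/-- The POVM of the composite measurement `M ∘ Φ` (first apply `Φ`, then measure `M`). -/
def preComp {A C ι : Type} [DecidableEq A] [Fintype C] (M : ι → Op C) (Φ : SOp A C) :
    ι → Op A :=
  fun x => dual Φ (M x)

open Classical in
/-- Quantum relative entropy `D(P ‖ Q) = tr P (log P - log Q)` of positive semidefinite operators,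
with value `+∞` unless `ker Q ⊆ ker P`. As `Real.log 0 = 0`, the logarithms are taken
on the supports. -/
def relEntropy {A : Type} [Fintype A] [DecidableEq A] (P Q : Op A) : EReal :=
  if ∀ v : A → ℂ, Q.mulVec v = 0 → P.mulVec v = 0 then
    (((P * (cfc Real.log P - cfc Real.log Q)).trace.re : ℝ) : EReal)
  else ⊤

/-- Measurement relative entropy: the sum of the relative entropies of the POVM elements divided
by the dimension of the measured system. -/
def measRelEntropy {A ι : Type} [Fintype A] [DecidableEq A] [Fintype ι] (M N : ι → Op A) :
    EReal :=
  (((Fintype.card A : ℝ)⁻¹ : ℝ) : EReal) * ∑ x, relEntropy (M x) (N x)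

/-! ### Coherence -/

/-- The dephasing channel `Δ` in the incoherent basis. -/
def dephase (A : Type) [DecidableEq A] : SOp A A :=
  Matrix.diagonalLinearMap A ℂ ℂ ∘ₗ Matrix.diagLinearMap A ℂ ℂ

/-- Incoherent measurements: POVMs all of whose elements are diagonal. -/
def IsIncoherentMeas {A ι : Type} [DecidableEq A] [Fintype ι] (M : ι → Op A) : Prop :=
  IsPOVM M ∧ ∀ x, dephase A (M x) = M x

/-- Detection-incoherent operations: channels with `Δ ∘ Φ = Δ ∘ Φ ∘ Δ`. -/
def IsDIO {A : Type} [Fintype A] [DecidableEq A] (Φ : SOp A A) : Prop :=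
  IsChannel Φ ∧ dephase A ∘ₗ Φ = dephase A ∘ₗ Φ ∘ₗ dephase A

/-- Measurement-cohering power of `Φ`: the minimum over detection-incoherent operations `F` of the
maximum, over all ancillas (of dimension `k`) and all incoherent measurements `M` (with any number
`n` of outcomes) of system and ancilla, of `D_m (M ∘ Φ ‖ M ∘ F)`. -/
def cohPower {A : Type} [Fintype A] [DecidableEq A] (Φ : SOp A A) : EReal :=
  ⨅ (F : SOp A A) (_ : IsDIO F),
    ⨆ (k : ℕ) (_ : 0 < k) (n : ℕ) (M : Fin n → Op (A × Fin k)) (_ : IsIncoherentMeas M),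
      measRelEntropy (preComp M (ampL (Fin k) Φ)) (preComp M (ampL (Fin k) F))

/-! ### Entanglement -/

/-- One-way LOCC channels from `A : B` to `C : D` with communication from left to right: the left
party applies an instrument and sends its outcome, on which the channel of the right party
depends. -/
def IsOneWayRight {A B C D : Type} [Fintype A] [Fintype B] [Fintype C] [Fintype D]
    (Ξ : SOp (A × B) (C × D)) : Prop :=
  ∃ (n : ℕ) (Φ : Fin n → SOp A C) (Ψ : Fin n → SOp B D),
    (∀ x, IsCP (Φ x)) ∧ IsTP (∑ x, Φ x) ∧ (∀ x, IsChannel (Ψ x)) ∧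
      Ξ = ∑ x, tensor (Φ x) (Ψ x)

/-- One-way LOCC channels with communication from right to left. -/
def IsOneWayLeft {A B C D : Type} [Fintype A] [Fintype B] [Fintype C] [Fintype D]
    (Ξ : SOp (A × B) (C × D)) : Prop :=
  ∃ (n : ℕ) (Φ : Fin n → SOp A C) (Ψ : Fin n → SOp B D),
    (∀ x, IsChannel (Φ x)) ∧ (∀ x, IsCP (Ψ x)) ∧ IsTP (∑ x, Ψ x) ∧
      Ξ = ∑ x, tensor (Φ x) (Ψ x)

/-- LOCC channels: finite compositions of one-way LOCC channels, the intermediate local systems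
being arbitrary finite-dimensional. -/
inductive IsLOCC : ∀ {A B C D : Type} [Fintype A] [Fintype B] [Fintype C] [Fintype D],
    SOp (A × B) (C × D) → Prop
  | right {A B C D : Type} [Fintype A] [Fintype B] [Fintype C] [Fintype D]
      {Ξ : SOp (A × B) (C × D)} (h : IsOneWayRight Ξ) : IsLOCC Ξ
  | left {A B C D : Type} [Fintype A] [Fintype B] [Fintype C] [Fintype D]
      {Ξ : SOp (A × B) (C × D)} (h : IsOneWayLeft Ξ) : IsLOCC Ξ
  | comp {A B C D E F : Type} [Fintype A] [Fintype B] [Fintype C] [Fintype D] [Fintype E]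
      [Fintype F] {Ξ : SOp (A × B) (C × D)} {Θ : SOp (C × D) (E × F)}
      (h₁ : IsLOCC Ξ) (h₂ : IsLOCC Θ) : IsLOCC (Θ ∘ₗ Ξ)

/-- The closure of the set of LOCC channels (the space of superoperators is finite-dimensional, so
that its topology is that of pointwise convergence). -/
def IsClosedLOCC {A B C D : Type} [Fintype A] [Fintype B] [Fintype C] [Fintype D]
    (Ξ : SOp (A × B) (C × D)) : Prop :=
  ∃ s : ℕ → SOp (A × B) (C × D), (∀ m, IsLOCC (s m)) ∧
    ∀ X : Op (A × B), Filter.Tendsto (fun m => s m X) Filter.atTop (𝓝 (Ξ X))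

/-- LOCC measurements: an LOCC channel followed by local measurements of the two parties, the
outcome being a function of the two local outcomes. -/
def IsLOCCMeas {A B ι : Type} [Fintype A] [Fintype B] [DecidableEq A] [DecidableEq B]
    [DecidableEq ι] (M : ι → Op (A × B)) : Prop :=
  ∃ (c d n m : ℕ) (Ξ : SOp (A × B) (Fin c × Fin d)) (P : Fin n → Op (Fin c))
    (Q : Fin m → Op (Fin d)) (f : Fin n × Fin m → ι),
    IsLOCC Ξ ∧ IsPOVM P ∧ IsPOVM Q ∧
      ∀ x, M x = ∑ p : Fin n × Fin m, if f p = x then dual Ξ (P p.1 ⊗ₖ Q p.2) else 0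

/-- The closure of the set of LOCC measurements with outcome set `ι`. -/
def IsClosedLOCCMeas {A B ι : Type} [Fintype A] [Fintype B] [DecidableEq A] [DecidableEq B]
    [DecidableEq ι] (M : ι → Op (A × B)) : Prop :=
  ∃ s : ℕ → ι → Op (A × B), (∀ m, IsLOCCMeas (s m)) ∧
    ∀ x, Filter.Tendsto (fun m => s m x) Filter.atTop (𝓝 (M x))

/-- Measurement-entangling power of `Φ`: the minimum over `F` in the closure of the LOCC channels of
the maximum, over all local ancillas (of dimensions `k` and `l`) and all measurements `M` (with any
number `n` of outcomes) in the closure of the LOCC measurements for the bipartition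
`(A A') : (B B')`, of `D_m (M ∘ Φ ‖ M ∘ F)`. -/
def entPower {A B : Type} [Fintype A] [Fintype B] [DecidableEq A] [DecidableEq B]
    (Φ : SOp (A × B) (A × B)) : EReal :=
  ⨅ (F : SOp (A × B) (A × B)) (_ : IsClosedLOCC F),
    ⨆ (k : ℕ) (_ : 0 < k) (l : ℕ) (_ : 0 < l) (n : ℕ)
      (M : Fin n → Op ((A × Fin k) × (B × Fin l))) (_ : IsClosedLOCCMeas M),
      measRelEntropy (preComp M (extend (Fin k) (Fin l) Φ))
        (preComp M (extend (Fin k) (Fin l) F))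

end QMeas

end

/-! Fix a detection-incoherent channel `F` on `A` and compare `E` with it: write `G_E` and `G_F` for
the channels `Δ K E L` and `Δ K F L` on `AB`. It suffices that `G_F` is LOCC and that every POVM
separates `G_E` from `G_F` by at most the inner supremum of `cohPower E` at `F`.

Since `K`, `F`, `L` are detection-incoherent, `Δ` can be moved to the input, so `G_F = Δ G_F Δ` is a
classical channel. It is LOCC (`isLOCC_of_dephase_comp_comp_dephase`): measure `A`, let the other
party simulate the channel, and send one label back.

For the entropy bound, pull a POVM element `M x` back through `Δ K` (with ancillas). The result is
block diagonal in the basis of `A`, with blocks `N x a` on `B` and the ancillas. Hence `tr (P x * X)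
= ∑ a, tr (E†|a⟩⟨a| * Θ x a X)`, where `P x` is the pulled-back element for `G_E` and `Θ x a`
applies `L` and then the partial trace weighted by `N x a`. The same `Θ x a` serve for `F`. They are
completely positive and, `L` being unital, send `1` to `r x a • 1` with `r x a = tr (N x a)`. Joint
monotonicity (`realRelEntropy_le_sum`) bounds the entropy for outcome `x` by `∑ a, r x a *
D(E†|a⟩⟨a| ‖ F†|a⟩⟨a|)`. Since `∑ x, N x a = 1`, summing over `x` and normalizing leaves the average
over `a` of these entropies, which the incoherent basis measurement attains as a lower bound of the
supremum.

Joint monotonicity is proved by writing `D(P ‖ Q)` as a regularized integral over `s` of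
`modularSum`, which is the maximum over `X` of the quadratic functional `modularForm`. The Schwarz
inequality for completely positive maps compares these maxima for each `s`. -/

noncomputable section

namespace QMeas

/-! ### Completely positive maps -/

theorem IsCP.ampL_posSemidef {A C R : Type} [Fintype R] {Φ : SOp A C} (h : IsCP Φ)
    {X : Op (A × R)} (hX : X.PosSemidef) : (ampL R Φ X).PosSemidef := by
  let e := Fintype.equivFin R
  have key := h _ _ (hX.submatrix (Prod.map id e.symm))
  have := key.submatrix (Prod.map id e)
  convert this using 1
  ext p q
  simp [ampL]

theorem IsCP.posSemidef {A C : Type} {Φ : SOp A C} (h : IsCP Φ) {X : Op A} (hX : X.PosSemidef) :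
    (Φ X).PosSemidef :=
  (h 1 _ (hX.submatrix Prod.fst)).submatrix fun c => (c, 0)

theorem IsCP.comp {A C D : Type} {Φ : SOp A C} {Ψ : SOp C D} (hΨ : IsCP Ψ) (hΦ : IsCP Φ) :
    IsCP (Ψ ∘ₗ Φ) :=
  fun k X hX => hΨ k _ (hΦ k X hX)

theorem IsCP.ampL {A C : Type} (R : Type) [Fintype R] {Φ : SOp A C} (h : IsCP Φ) :
    IsCP (ampL R Φ) := by
  intro k X hX
  exact (h.ampL_posSemidef (hX.submatrix (Equiv.prodAssoc A R (Fin k)).symm)).submatrix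
    (Equiv.prodAssoc C R (Fin k))

theorem IsCP.ampR {B D : Type} (R : Type) [Fintype R] {Ψ : SOp B D} (h : IsCP Ψ) :
    IsCP (ampR R Ψ) := by
  intro k X hX
  let e : ∀ T : Type, T × (R × Fin k) ≃ (R × T) × Fin k := fun T =>
    (Equiv.prodAssoc T R (Fin k)).symm.trans ((Equiv.prodComm T R).prodCongr (Equiv.refl _))
  exact (h.ampL_posSemidef (hX.submatrix (e B))).submatrix (e D).symm

theorem IsCP.tensor {A B C D : Type} [Fintype A] [Fintype D] {Φ : SOp A C} {Ψ : SOp B D}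
    (hΦ : IsCP Φ) (hΨ : IsCP Ψ) : IsCP (tensor Φ Ψ) :=
  (hΦ.ampL D).comp (hΨ.ampR A)

theorem IsCP.sum {A C ι : Type} (s : Finset ι) {Φ : ι → SOp A C} (h : ∀ i, IsCP (Φ i)) :
    IsCP (∑ i ∈ s, Φ i) := by
  intro k X hX
  have : QMeas.ampL (Fin k) (∑ i ∈ s, Φ i) X = ∑ i ∈ s, QMeas.ampL (Fin k) (Φ i) X := by
    ext p q
    simp [QMeas.ampL, Matrix.sum_apply]
  rw [this]
  exact Matrix.posSemidef_sum _ fun i _ => h i k X hX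

/-- The completely positive map `X ↦ V X V*`. -/
def conj {A C : Type} [Fintype A] (V : Matrix C A ℂ) : SOp A C where
  toFun X := V * X * V.conjTranspose
  map_add' X Y := by rw [Matrix.mul_add, Matrix.add_mul]
  map_smul' c X := by simp

theorem conj_apply {A C : Type} [Fintype A] (V : Matrix C A ℂ) (X : Op A) :
    conj V X = V * X * V.conjTranspose := rfl

theorem isCP_conj {A C : Type} [Fintype A] [Fintype C] (V : Matrix C A ℂ) : IsCP (conj V) := by
  intro k X hX
  have := hX.mul_mul_conjTranspose_same (V ⊗ₖ (1 : Matrix (Fin k) (Fin k) ℂ))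
  convert this using 1
  ext p q
  simp [ampL, conj, Matrix.mul_apply, Fintype.sum_prod_type, Matrix.one_apply,
    Matrix.conjTranspose_apply, apply_ite]

/-- Relabelling of the basis. -/
def relabel {A C : Type} (e : A ≃ C) : SOp A C :=
  (Matrix.reindexLinearEquiv ℂ ℂ e e).toLinearMap

theorem isCP_relabel {A C : Type} (e : A ≃ C) : IsCP (relabel e) := by
  intro k X hX
  exact hX.submatrix (Prod.map e.symm id)

/-! ### Dephasing -/

theorem dephase_apply {A : Type} [DecidableEq A] (X : Op A) (i j : A) :
    dephase A X i j = if i = j then X i i else 0 := by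
  simp [dephase, Matrix.diagonal_apply]

theorem isCP_dephase (A : Type) [Fintype A] [DecidableEq A] : IsCP (dephase A) := by
  have : dephase A = ∑ a, conj (Matrix.single a a (1 : ℂ)) := by
    ext1 X
    ext i j
    rw [dephase_apply, LinearMap.sum_apply, Matrix.sum_apply]
    have h : ∀ a, conj (Matrix.single a a (1 : ℂ)) X = Matrix.single a a (X a a) := by
      intro a
      simp [conj_apply, Matrix.single_mul_mul_single]
    simp only [h, Matrix.single_apply]
    split_ifs with hij
    · subst hij; simp
    · refine (Finset.sum_eq_zero fun a _ => if_neg ?_).symm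
      rintro ⟨rfl, h⟩
      exact hij h
  rw [this]
  exact IsCP.sum _ fun a => isCP_conj _

theorem isTP_dephase (A : Type) [Fintype A] [DecidableEq A] : IsTP (dephase A) := by
  intro X
  simp [Matrix.trace, dephase_apply]

/-! ### Trace preservation -/

theorem IsTP.comp {A C D : Type} [Fintype A] [Fintype C] [Fintype D] {Φ : SOp A C} {Ψ : SOp C D}
    (hΨ : IsTP Ψ) (hΦ : IsTP Φ) : IsTP (Ψ ∘ₗ Φ) :=
  fun X => (hΨ _).trans (hΦ X)

theorem IsTP.ampL {A C : Type} (R : Type) [Fintype A] [Fintype C] [Fintype R] {Φ : SOp A C}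
    (h : IsTP Φ) : IsTP (ampL R Φ) := by
  intro X
  simp only [Matrix.trace, Matrix.diag, Fintype.sum_prod_type]
  rw [Finset.sum_comm, Finset.sum_comm (s := (Finset.univ : Finset A))]
  exact Finset.sum_congr rfl fun r _ => h (Matrix.of fun i k => X (i, r) (k, r))

theorem IsTP.ampR {B D : Type} (R : Type) [Fintype B] [Fintype D] [Fintype R] {Ψ : SOp B D}
    (h : IsTP Ψ) : IsTP (ampR R Ψ) := by
  intro X
  simp only [Matrix.trace, Matrix.diag, Fintype.sum_prod_type]
  exact Finset.sum_congr rfl fun r _ => h (Matrix.of fun i k => X (r, i) (r, k))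

theorem isTP_relabel {A C : Type} [Fintype A] [Fintype C] (e : A ≃ C) : IsTP (relabel e) := by
  intro X
  exact Equiv.sum_comp e.symm fun i => X i i

theorem IsTP.extend {A B : Type} [Fintype A] [Fintype B] (A' B' : Type) [Fintype A'] [Fintype B']
    {Φ : SOp (A × B) (A × B)} (h : IsTP Φ) : IsTP (extend A' B' Φ) :=
  (isTP_relabel _).comp ((h.ampL _).comp (isTP_relabel _))

/-! ### Positivity of adjoint maps -/

theorem trace_mul_nonneg {A : Type} [Fintype A] {X Y : Op A} (hX : X.PosSemidef)
    (hY : Y.PosSemidef) : 0 ≤ (X * Y).trace := by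
  obtain ⟨m, v, rfl⟩ := Matrix.posSemidef_iff_eq_sum_vecMulVec.1 hX
  rw [Finset.sum_mul, Matrix.trace_sum]
  refine Finset.sum_nonneg fun i _ => ?_
  rw [Matrix.vecMulVec_mul, Matrix.trace_vecMulVec, dotProduct_comm, ← Matrix.dotProduct_mulVec]
  exact hY.dotProduct_mulVec_nonneg _

/-- Nonnegativity in the order of `ℂ` includes being real, and over `ℂ` a real quadratic form
already forces the matrix to be Hermitian. -/
theorem posSemidef_of_forall_dotProduct_nonneg {A : Type} [Fintype A] {X : Op A}
    (h : ∀ v : A → ℂ, 0 ≤ star v ⬝ᵥ X.mulVec v) : X.PosSemidef := by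
  classical
  rw [← Matrix.isPositive_toEuclideanLin_iff, LinearMap.isPositive_iff_complex]
  intro x
  have h1 := h x.ofLp
  have h2 : inner ℂ (Matrix.toEuclideanLin X x) x = star (star x.ofLp ⬝ᵥ X.mulVec x.ofLp) := by
    rw [EuclideanSpace.inner_eq_star_dotProduct, ← Matrix.star_dotProduct_star, star_star,
      dotProduct_comm]
    rfl
  obtain ⟨hre, him⟩ := Complex.le_def.1 h1
  rw [h2]
  refine ⟨?_, by simpa using hre⟩
  apply Complex.ext <;> simp at *
  simp [← him]

/-- Self-duality of the positive semidefinite cone; testing on rank-one matrices is enough. -/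
theorem posSemidef_of_forall_trace_mul_nonneg {A : Type} [Fintype A] {X : Op A}
    (h : ∀ Y : Op A, Y.PosSemidef → 0 ≤ (X * Y).trace) : X.PosSemidef := by
  refine posSemidef_of_forall_dotProduct_nonneg fun v => ?_
  have := h _ (Matrix.posSemidef_vecMulVec_self_star v)
  rwa [Matrix.mul_vecMulVec, Matrix.trace_vecMulVec, dotProduct_comm] at this

theorem dual_posSemidef {A C : Type} [Fintype A] [DecidableEq A] [Fintype C] {Φ : SOp A C}
    (h : IsCP Φ) {Y : Op C} (hY : Y.PosSemidef) : (dual Φ Y).PosSemidef :=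
  posSemidef_of_forall_trace_mul_nonneg fun X hX => by
    rw [trace_dual_mul]
    exact trace_mul_nonneg hY (h.posSemidef hX)

theorem dual_one {A C : Type} [Fintype A] [DecidableEq A] [Fintype C] [DecidableEq C]
    {Φ : SOp A C} (h : IsTP Φ) : dual Φ 1 = 1 := by
  rw [Matrix.ext_iff_trace_mul_right]
  intro X
  rw [trace_dual_mul, one_mul, one_mul, h]

theorem dual_sum {A C ι : Type} [Fintype A] [DecidableEq A] [Fintype C] (Φ : SOp A C)
    (s : Finset ι) (Y : ι → Op C) : dual Φ (∑ i ∈ s, Y i) = ∑ i ∈ s, dual Φ (Y i) := by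
  rw [Matrix.ext_iff_trace_mul_right]
  intro X
  simp only [Finset.sum_mul, Matrix.trace_sum, trace_dual_mul]

theorem IsPOVM.dual {A C ι : Type} [Fintype A] [DecidableEq A] [Fintype C] [DecidableEq C]
    [Fintype ι] {M : ι → Op C} (hM : IsPOVM M) {Φ : SOp A C} (hΦ : IsChannel Φ) :
    IsPOVM fun x => dual Φ (M x) :=
  ⟨fun x => dual_posSemidef hΦ.1 (hM.1 x), by rw [← dual_sum, hM.2, dual_one hΦ.2]⟩

/-! ### LOCC -/

theorem linearMap_ext_kronecker {A B : Type} [Finite A] [Finite B] {M : Type*} [AddCommMonoid M]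
    [Module ℂ M] {f g : Op (A × B) →ₗ[ℂ] M} (h : ∀ X Y, f (X ⊗ₖ Y) = g (X ⊗ₖ Y)) : f = g := by
  classical
  have := Fintype.ofFinite A
  have := Fintype.ofFinite B
  refine Matrix.ext_linearMap (R := ℂ) fun p q => ?_
  ext1
  have := h (Matrix.single p.1 q.1 1) (Matrix.single p.2 q.2 1)
  rwa [Matrix.single_kronecker_single, mul_one] at this

theorem isTP_sum_tensor {A B C D ι : Type} [Fintype A] [Fintype B] [Fintype C] [Fintype D]
    [Fintype ι] {Φ : ι → SOp A C} {Ψ : ι → SOp B D}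
    (h : ∀ X Y, ∑ x, (Φ x X).trace * (Ψ x Y).trace = X.trace * Y.trace) :
    IsTP (∑ x, tensor (Φ x) (Ψ x)) := by
  have : Matrix.traceLinearMap (C × D) ℂ ℂ ∘ₗ (∑ x, tensor (Φ x) (Ψ x)) =
      Matrix.traceLinearMap (A × B) ℂ ℂ := by
    refine linearMap_ext_kronecker fun X Y => ?_
    simp [tensor_kronecker, Matrix.trace_kronecker, h]
  exact fun X => LinearMap.congr_fun this X

theorem IsLOCC.isChannel {A B C D : Type} [Fintype A] [Fintype B] [Fintype C] [Fintype D]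
    {Ξ : SOp (A × B) (C × D)} (h : IsLOCC Ξ) : IsChannel Ξ := by
  induction h with
  | right h =>
    obtain ⟨n, Φ, Ψ, hΦ, hΦ', hΨ, rfl⟩ := h
    refine ⟨IsCP.sum _ fun x => (hΦ x).tensor (hΨ x).1, isTP_sum_tensor fun X Y => ?_⟩
    have := hΦ' X
    simp only [LinearMap.sum_apply, Matrix.trace_sum] at this
    simp only [(hΨ _).2 Y, ← Finset.sum_mul, this]
  | left h =>
    obtain ⟨n, Φ, Ψ, hΦ, hΨ, hΨ', rfl⟩ := h
    refine ⟨IsCP.sum _ fun x => (hΦ x).1.tensor (hΨ x), isTP_sum_tensor fun X Y => ?_⟩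
    have := hΨ' Y
    simp only [LinearMap.sum_apply, Matrix.trace_sum] at this
    simp only [(hΦ _).2 X, ← Finset.mul_sum, this]
  | comp _ _ h₁ h₂ => exact ⟨h₂.1.comp h₁.1, h₂.2.comp h₁.2⟩

theorem IsLOCCMeas.isPOVM {A B ι : Type} [Fintype A] [Fintype B] [DecidableEq A] [DecidableEq B]
    [DecidableEq ι] [Fintype ι] {M : ι → Op (A × B)} (h : IsLOCCMeas M) : IsPOVM M := by
  obtain ⟨c, d, n, m, Ξ, P, Q, f, hΞ, hP, hQ, hM⟩ := h
  have hpos : ∀ p : Fin n × Fin m, (dual Ξ (P p.1 ⊗ₖ Q p.2)).PosSemidef := fun p =>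
    dual_posSemidef hΞ.isChannel.1 ((hP.1 _).kronecker (hQ.1 _))
  refine ⟨fun x => ?_, ?_⟩
  · rw [hM]
    refine Matrix.posSemidef_sum _ fun p _ => ?_
    split_ifs
    exacts [hpos p, .zero]
  · have hsum : ∑ p : Fin n × Fin m, P p.1 ⊗ₖ Q p.2 = 1 := by
      ext i j
      have h1 := congrFun (congrFun hP.2 i.1) j.1
      have h2 := congrFun (congrFun hQ.2 i.2) j.2
      rw [Matrix.sum_apply] at h1 h2 ⊢
      simp only [Matrix.kroneckerMap_apply, Fintype.sum_prod_type, ← Finset.mul_sum,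
        ← Finset.sum_mul, h1, h2]
      rw [← Matrix.one_kronecker_one, Matrix.kroneckerMap_apply]
    simp only [hM]
    rw [Finset.sum_comm]
    simp only [Finset.sum_ite_eq, Finset.mem_univ, if_true]
    rw [← dual_sum, hsum, dual_one hΞ.isChannel.2]

theorem posSemidef_of_tendsto {A : Type} [Fintype A] {s : ℕ → Op A} {X : Op A}
    (hs : ∀ m, (s m).PosSemidef) (h : Filter.Tendsto s Filter.atTop (𝓝 X)) : X.PosSemidef := by
  refine posSemidef_of_forall_dotProduct_nonneg fun v => ?_
  have hc : Continuous fun Y : Op A => star v ⬝ᵥ Y.mulVec v := by fun_prop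
  exact ge_of_tendsto' ((hc.tendsto X).comp h) fun m => (hs m).dotProduct_mulVec_nonneg v

/-- The POVM conditions are closed. The entropy bound holds for all POVMs, so nothing more about
LOCC measurements is needed. -/
theorem IsClosedLOCCMeas.isPOVM {A B ι : Type} [Fintype A] [Fintype B] [DecidableEq A]
    [DecidableEq B] [DecidableEq ι] [Fintype ι] {M : ι → Op (A × B)} (h : IsClosedLOCCMeas M) :
    IsPOVM M := by
  obtain ⟨s, hs, ht⟩ := h
  refine ⟨fun x => posSemidef_of_tendsto (fun m => (hs m).isPOVM.1 x) (ht x), ?_⟩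
  refine tendsto_nhds_unique (tendsto_finsetSum _ fun x _ => ht x) ?_
  simp only [(hs _).isPOVM.2, tendsto_const_nhds]


/-! ### Classical channels are LOCC -/

/-- A channel that dephases its input and its output is implemented by measuring `A`, sending the
outcome to the second party, applying the channel there, and sending back the first label. -/
theorem isLOCC_of_dephase_comp_comp_dephase {A B : Type} [Fintype A] [DecidableEq A] [Fintype B]
    [DecidableEq B] {G : SOp (A × B) (A × B)} (hG : IsChannel G)
    (h : dephase (A × B) ∘ₗ G ∘ₗ dephase (A × B) = G) : IsLOCC G := by
  let e := Fintype.equivFin A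
  -- `Φ₁ x` projects onto label `x` and leaves a trivial system; `Ψ₁ x` adjoins `|x⟩` on the other
  -- side. On the way back, `Ψ₂ x` applies `G` and keeps the block where the `A`-label is `x`, and
  -- `Φ₂ x` prepares `|x⟩`.
  let Φ₁ : Fin (Fintype.card A) → SOp A Unit := fun x =>
    conj (Matrix.of fun _ a => if a = e.symm x then 1 else 0)
  let Ψ₁ : Fin (Fintype.card A) → SOp B (A × B) := fun x =>
    conj (Matrix.of fun p b => if p = (e.symm x, b) then 1 else 0)
  let Φ₂ : Fin (Fintype.card A) → SOp Unit A := fun x =>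
    conj (Matrix.of fun a _ => if a = e.symm x then 1 else 0)
  let V : A → Matrix B (A × B) ℂ := fun a => Matrix.of fun b p => if p = (a, b) then 1 else 0
  let Ψ₂ : Fin (Fintype.card A) → SOp (A × B) B := fun x => conj (V (e.symm x)) ∘ₗ G
  have eΦ₁ : ∀ x (X : Op A), Φ₁ x X = Matrix.of fun _ _ => X (e.symm x) (e.symm x) := by
    intro x X
    ext i j
    simp [Φ₁, conj_apply, Matrix.mul_apply, apply_ite]
  have eΨ₁ : ∀ x (Y : Op B), Ψ₁ x Y = Matrix.single (e.symm x) (e.symm x) 1 ⊗ₖ Y := by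
    intro x Y
    ext i j
    simp [Ψ₁, conj_apply, Matrix.mul_apply, apply_ite, Matrix.single_apply, Prod.ext_iff, ite_and,
      eq_comm]
    split_ifs <;> simp_all
  have eΦ₂ : ∀ x (X : Op Unit), Φ₂ x X = X () () • Matrix.single (e.symm x) (e.symm x) 1 := by
    intro x Y
    ext i j
    simp [Φ₂, conj_apply, Matrix.mul_apply, apply_ite, Matrix.single_apply, ite_and, eq_comm]
    split_ifs <;> simp_all
  have eV : ∀ a (Z : Op (A × B)), conj (V a) Z = Z.submatrix (a, ·) (a, ·) := by
    intro a Z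
    ext i j
    simp [V, conj_apply, Matrix.mul_apply, apply_ite]
  have h₁ : IsOneWayRight (∑ x, tensor (Φ₁ x) (Ψ₁ x)) := by
    refine ⟨_, Φ₁, Ψ₁, fun x => isCP_conj _, fun X => ?_, fun x => ⟨isCP_conj _, fun Y => ?_⟩, rfl⟩
    · simp only [LinearMap.sum_apply, eΦ₁, Matrix.trace_sum]
      simp [Matrix.trace, Equiv.sum_comp e.symm fun a => X a a]
    · simp [eΨ₁, Matrix.trace_kronecker]
  have h₂ : IsOneWayLeft (∑ x, tensor (Φ₂ x) (Ψ₂ x)) := by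
    refine ⟨_, Φ₂, Ψ₂, fun x => ⟨isCP_conj _, fun X => ?_⟩, fun x => (isCP_conj _).comp hG.1,
      fun Z => ?_, rfl⟩
    · simp [eΦ₂, Matrix.trace]
    · rw [← hG.2 Z]
      simp only [LinearMap.sum_apply, Ψ₂, LinearMap.comp_apply, eV, Matrix.trace_sum]
      simp [Matrix.trace, Equiv.sum_comp e.symm fun a => ∑ b, G Z (a, b) (a, b),
        Fintype.sum_prod_type]
  have key : (∑ x, tensor (Φ₂ x) (Ψ₂ x)) ∘ₗ (∑ x, tensor (Φ₁ x) (Ψ₁ x)) = G := by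
    refine linearMap_ext_kronecker fun X Y => ?_
    simp only [LinearMap.comp_apply, LinearMap.sum_apply, map_sum, tensor_kronecker, eΦ₁, eΨ₁, eΦ₂,
      Ψ₂, eV]
    have hd : ∀ W Z, dephase (A × B) W = dephase (A × B) Z → G W = G Z := by
      intro W Z hWZ
      rw [← h]
      simp only [LinearMap.comp_apply, hWZ]
    have hoff : ∀ Z i j, i ≠ j → G Z i j = 0 := by
      intro Z i j hij
      rw [← h]
      simp [dephase_apply, hij]
    -- `G` sees only the diagonal of its input, so measuring `A` beforehand changes nothing.
    have hZ : G (X ⊗ₖ Y) = G (∑ x, X (e.symm x) (e.symm x) •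
        (Matrix.single (e.symm x) (e.symm x) (1 : ℂ) ⊗ₖ Y)) := by
      rw [Equiv.sum_comp e.symm fun a => X a a • (Matrix.single a a (1 : ℂ) ⊗ₖ Y)]
      apply hd
      ext i j
      simp [dephase_apply, Matrix.sum_apply, Matrix.single_apply]
    rw [hZ, map_sum]
    simp only [map_smul, Matrix.smul_kronecker]
    rw [Finset.sum_congr rfl fun x _ => (Finset.smul_sum ..).symm]
    simp only [Matrix.of_apply]
    refine Finset.sum_congr rfl fun x _ => congrArg (X (e.symm x) (e.symm x) • ·) ?_
    ext i j
    rw [Matrix.sum_apply, Equiv.sum_comp e.symm fun a => (Matrix.single a a (1 : ℂ) ⊗ₖ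
      (G (Matrix.single (e.symm x) (e.symm x) 1 ⊗ₖ Y)).submatrix (a, ·) (a, ·)) i j]
    -- The output of `G` is diagonal, so keeping only its diagonal blocks loses nothing.
    by_cases hij : i = j
    · subst hij
      simp [Matrix.single_apply]
    · rw [hoff _ _ _ hij]
      refine Finset.sum_eq_zero fun a _ => ?_
      by_cases ha : a = i.1 ∧ a = j.1
      · have hne : (a, i.2) ≠ (a, j.2) := fun hc =>
          hij (Prod.ext (ha.1.symm.trans ha.2) (Prod.ext_iff.1 hc).2)
        simp [hoff _ _ _ hne]
      · simp [ha]
  rw [← key]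
  exact (IsLOCC.right h₁).comp (IsLOCC.left h₂)

theorem IsLOCC.isClosedLOCC {A B C D : Type} [Fintype A] [Fintype B] [Fintype C] [Fintype D]
    {Ξ : SOp (A × B) (C × D)} (h : IsLOCC Ξ) : IsClosedLOCC Ξ :=
  ⟨fun _ => Ξ, fun _ => h, fun _ => tendsto_const_nhds⟩

theorem dephase_comp_dephase {A : Type} [DecidableEq A] : dephase A ∘ₗ dephase A = dephase A := by
  ext1 X
  ext i j
  simp [dephase_apply]

/-- A diagonal entry of the output with `B`-label `b` depends only on the diagonal block of the
input at `b`, where the condition on `F` applies. -/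
theorem IsDIO.dephase_comp_ampL {A B : Type} [Fintype A] [DecidableEq A] [DecidableEq B]
    {F : SOp A A} (h : IsDIO F) :
    dephase (A × B) ∘ₗ ampL B F = dephase (A × B) ∘ₗ ampL B F ∘ₗ dephase (A × B) := by
  ext1 X
  ext p q
  simp only [LinearMap.comp_apply, dephase_apply]
  refine if_congr Iff.rfl ?_ rfl
  have h1 := congrFun (congrFun (LinearMap.congr_fun h.2 (Matrix.of fun i k => X (i, p.2) (k, p.2)))
    p.1) p.1
  simp only [LinearMap.comp_apply, dephase_apply, if_true] at h1
  refine h1.trans (congrArg (fun Z => F Z p.1 p.1) ?_)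
  ext i k
  simp [dephase_apply]


/-! ### The Schwarz inequality for completely positive maps -/

/-- Stack `X` on `1` to form `W`; then `W W*` is positive with blocks `X X*`, `X`, `X*`, `1`, and
the amplification of `Θ` by a two-dimensional ancilla acts blockwise. -/
theorem IsCP.posSemidef_fromBlocks {A S : Type} [Fintype S] [DecidableEq S]
    {Θ : SOp S A} (h : IsCP Θ) (X : Op S) :
    (Matrix.fromBlocks (Θ (X * X.conjTranspose)) (Θ X) (Θ X.conjTranspose) (Θ 1)).PosSemidef := by
  let W : Matrix (S × Fin 2) S ℂ := Matrix.of fun p k => if p.2 = 0 then X p.1 k else (1 : Op S) p.1 k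
  have hW := (h 2 _ (Matrix.posSemidef_self_mul_conjTranspose W)).submatrix
    (Sum.elim (fun i : A => (i, (0 : Fin 2))) fun i => (i, 1))
  convert hW using 1
  have h1 : ∀ u v : Fin 2, (Matrix.of fun i k => (W * W.conjTranspose) (i, u) (k, v)) =
      (if u = 0 then X else 1) * (if v = 0 then X else 1).conjTranspose := by
    intro u v
    ext i k
    simp only [Matrix.of_apply, Matrix.mul_apply, Matrix.conjTranspose_apply, W]
    split_ifs <;> rfl
  ext (i | i) (j | j) <;> simp [QMeas.ampL, h1]

theorem IsCP.map_conjTranspose {A S : Type} [Fintype S] {Θ : SOp S A} (h : IsCP Θ) (X : Op S) :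
    Θ X.conjTranspose = (Θ X).conjTranspose := by
  classical
  exact (Matrix.isHermitian_fromBlocks_iff.1 (h.posSemidef_fromBlocks X).1).2.1.symm

/-- A positive block matrix with a vanishing diagonal block has vanishing off-diagonal blocks. This
covers the weights equal to zero in the joint monotonicity. -/
theorem IsCP.map_eq_zero_of_map_one {A S : Type} [Fintype A] [Fintype S] [DecidableEq S]
    {Θ : SOp S A} (h : IsCP Θ) (h1 : Θ 1 = 0) (X : Op S) : Θ X = 0 := by
  have hM := h.posSemidef_fromBlocks X
  rw [h1] at hM
  refine Matrix.mulVec_injective (funext fun w => ?_)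
  have h2 := (hM.dotProduct_mulVec_zero_iff (Sum.elim 0 w)).1 (by
    simp [Matrix.fromBlocks_mulVec, dotProduct, Fintype.sum_sum_type])
  rw [Matrix.fromBlocks_mulVec] at h2
  simpa using congrArg (fun f => f ∘ Sum.inl) h2

/-- Schur complement of the positive block matrix with respect to its corner `r • 1`. For `r = 0`
the inverse is `0` by convention and only positivity of `Θ` remains. -/
theorem IsCP.schwarz {A S : Type} [Fintype A] [DecidableEq A] [Fintype S] [DecidableEq S]
    {Θ : SOp S A} (h : IsCP Θ) {r : ℝ} (hr : 0 ≤ r) (h1 : Θ 1 = (r : ℂ) • 1) (X : Op S) :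
    (Θ (X * X.conjTranspose) - (r : ℂ)⁻¹ • (Θ X * (Θ X).conjTranspose)).PosSemidef := by
  rcases hr.eq_or_lt with rfl | hr
  · simpa using h.posSemidef (Matrix.posSemidef_self_mul_conjTranspose X)
  · have hM := h.posSemidef_fromBlocks X
    have hD : ((r : ℂ) • (1 : Op A)).PosDef := Matrix.PosDef.one.smul (by exact_mod_cast hr)
    have hinv : ((r : ℂ) • (1 : Op A))⁻¹ = (r : ℂ)⁻¹ • 1 := by
      refine Matrix.inv_eq_right_inv ?_
      rw [Matrix.smul_mul, Matrix.one_mul, smul_smul, mul_inv_cancel₀ (by exact_mod_cast hr.ne'),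
        one_smul]
    rw [h1, h.map_conjTranspose] at hM
    have := hD.isUnit.invertible
    have := (Matrix.PosDef.fromBlocks₂₂ _ _ hD).1 hM
    rw [hinv] at this
    simpa using this

/-! ### A variational formula -/

/-- The functional of `X` whose maximum is the quadratic form of a resolvent of the relative modular
operator of `P` and `Q`. -/
def modularForm {A : Type} [Fintype A] (P Q : Op A) (s : ℝ) (X : Op A) : ℝ :=
  2 * (P * X).trace.re - (Q * (X * X.conjTranspose)).trace.re
    - s * (P * (X.conjTranspose * X)).trace.re

section Overlap

variable {A : Type} [Fintype A] [DecidableEq A] {P Q : Op A}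

/-- The squared overlaps of the eigenvectors of `P` and `Q`. -/
def overlap (hP : P.IsHermitian) (hQ : Q.IsHermitian) (i j : A) : ℝ :=
  Complex.normSq ((star (hP.eigenvectorUnitary : Op A) * (hQ.eigenvectorUnitary : Op A)) i j)

theorem cfc_eq_mul_diagonal_mul (hP : P.IsHermitian) (f : ℝ → ℝ) :
    cfc f P = (hP.eigenvectorUnitary : Op A) *
      Matrix.diagonal (fun i => ((f (hP.eigenvalues i) : ℝ) : ℂ)) *
      star (hP.eigenvectorUnitary : Op A) := by
  rw [hP.cfc_eq, Matrix.IsHermitian.cfc, Unitary.conjStarAlgAut_apply]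
  rfl

theorem eq_mul_diagonal_mul (hP : P.IsHermitian) :
    P = (hP.eigenvectorUnitary : Op A) * Matrix.diagonal (fun i => (hP.eigenvalues i : ℂ)) *
      star (hP.eigenvectorUnitary : Op A) := by
  conv_lhs => rw [hP.spectral_theorem, Unitary.conjStarAlgAut_apply]
  rfl

theorem trace_mul_diagonal_mul_mul (U V : Op A) (f g : A → ℝ) :
    (U * Matrix.diagonal (fun i => (f i : ℂ)) * star U *
      (V * Matrix.diagonal (fun j => (g j : ℂ)) * star V)).trace.re =
      ∑ i, ∑ j, Complex.normSq ((star U * V) i j) * f i * g j := by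
  have h : (U * Matrix.diagonal (fun i => (f i : ℂ)) * star U *
      (V * Matrix.diagonal (fun j => (g j : ℂ)) * star V)).trace =
      (Matrix.diagonal (fun i => (f i : ℂ)) * (star U * V) * Matrix.diagonal (fun j => (g j : ℂ))
        * star (star U * V)).trace := by
    rw [Matrix.mul_assoc U, Matrix.mul_assoc U, Matrix.trace_mul_comm U]
    simp only [star_mul, star_star, Matrix.mul_assoc]
  rw [h]
  generalize star U * V = W
  simp only [Matrix.trace, Matrix.diag, Matrix.mul_apply (N := star W), Matrix.mul_diagonal,
    Matrix.diagonal_mul, Matrix.star_apply, Complex.re_sum]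
  refine Finset.sum_congr rfl fun i _ => Finset.sum_congr rfl fun j _ => ?_
  simp [Complex.normSq_apply]
  ring

theorem sum_overlap (hP : P.IsHermitian) (hQ : Q.IsHermitian) (i : A) :
    ∑ j, overlap hP hQ i j = 1 := by
  have h : (star (hP.eigenvectorUnitary : Op A) * (hQ.eigenvectorUnitary : Op A)) *
      star (star (hP.eigenvectorUnitary : Op A) * (hQ.eigenvectorUnitary : Op A)) = 1 := by
    rw [star_mul, star_star, Matrix.mul_assoc, ← Matrix.mul_assoc _ (star _)]
    simp
  have := congrFun (congrFun h i) i
  rw [Matrix.mul_apply, Matrix.one_apply_eq] at this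
  simp only [Matrix.star_apply, Complex.star_def, Complex.mul_conj] at this
  exact_mod_cast this

theorem trace_mul_log_sub_log (hP : P.IsHermitian) (hQ : Q.IsHermitian) :
    (P * (cfc Real.log P - cfc Real.log Q)).trace.re =
      ∑ i, ∑ j, overlap hP hQ i j * hP.eigenvalues i *
        (Real.log (hP.eigenvalues i) - Real.log (hQ.eigenvalues j)) := by
  have h1 : (P * cfc Real.log P).trace.re =
      ∑ i, ∑ j, overlap hP hQ i j * hP.eigenvalues i * Real.log (hP.eigenvalues i) := by
    -- The identity, written in the eigenbasis of `Q`, serves as second factor, so that `tr P log P`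
    -- takes the same double-sum form as the cross term.
    have h := trace_mul_diagonal_mul_mul (hP.eigenvectorUnitary : Op A) (hQ.eigenvectorUnitary : Op A)
      (fun i => hP.eigenvalues i * Real.log (hP.eigenvalues i)) fun _ => 1
    have e : P * cfc Real.log P = (hP.eigenvectorUnitary : Op A) *
        Matrix.diagonal (fun i => ((hP.eigenvalues i * Real.log (hP.eigenvalues i) : ℝ) : ℂ)) *
        star (hP.eigenvectorUnitary : Op A) := by
      conv_lhs => rw [cfc_eq_mul_diagonal_mul hP]; arg 1; rw [eq_mul_diagonal_mul hP]
      simp only [Complex.ofReal_mul, ← Matrix.diagonal_mul_diagonal, Matrix.mul_assoc]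
      rw [← Matrix.mul_assoc (star _)]
      simp
    have e2 : (hQ.eigenvectorUnitary : Op A) * Matrix.diagonal (fun _ => ((1 : ℝ) : ℂ)) *
        star (hQ.eigenvectorUnitary : Op A) = 1 := by simp
    rw [← e, e2, Matrix.mul_one] at h
    rw [h]
    simp [overlap, mul_assoc]
  have h2 : (P * cfc Real.log Q).trace.re =
      ∑ i, ∑ j, overlap hP hQ i j * hP.eigenvalues i * Real.log (hQ.eigenvalues j) := by
    conv_lhs => rw [cfc_eq_mul_diagonal_mul hQ]; arg 1; arg 1; arg 1; rw [eq_mul_diagonal_mul hP]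
    exact trace_mul_diagonal_mul_mul _ _ _ _
  rw [Matrix.mul_sub, Matrix.trace_sub, Complex.sub_re, h1, h2, ← Finset.sum_sub_distrib]
  simp only [← Finset.sum_sub_distrib, mul_sub]

/-- The maximum of `modularForm P Q s`. -/
def modularSum (hP : P.IsHermitian) (hQ : Q.IsHermitian) (s : ℝ) : ℝ :=
  ∑ i, ∑ j, overlap hP hQ i j * hP.eigenvalues i *
    (hP.eigenvalues i / (hQ.eigenvalues j + s * hP.eigenvalues i))

/-- In the eigenbases of `P` and `Q` the functional decouples into one scalar quadratic for each
entry of `Y`. -/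
theorem modularForm_mul_mul_star (hP : P.IsHermitian) (hQ : Q.IsHermitian) (s : ℝ) (Y : Op A) :
    modularForm P Q s ((hQ.eigenvectorUnitary : Op A) * Y * star (hP.eigenvectorUnitary : Op A)) =
      ∑ i, ∑ j, (2 * hP.eigenvalues i *
        ((star (hP.eigenvectorUnitary : Op A) * (hQ.eigenvectorUnitary : Op A)) i j * Y j i).re -
        (hQ.eigenvalues j + s * hP.eigenvalues i) * Complex.normSq (Y j i)) := by
  set U := (hP.eigenvectorUnitary : Op A) with hU
  set V := (hQ.eigenvectorUnitary : Op A) with hV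
  have hUU : star U * U = 1 := by simp [hU]
  have hVV : star V * V = 1 := by simp [hV]
  have c1 : ∀ Z, star U * (U * Z) = Z := fun Z => by rw [← Matrix.mul_assoc, hUU, Matrix.one_mul]
  have c2 : ∀ Z, star V * (V * Z) = Z := fun Z => by rw [← Matrix.mul_assoc, hVV, Matrix.one_mul]
  have t1 : (P * (V * Y * star U)).trace.re =
      ∑ i, ∑ j, hP.eigenvalues i * ((star U * V) i j * Y j i).re := by
    have : (P * (V * Y * star U)).trace =
        (Matrix.diagonal (fun i => (hP.eigenvalues i : ℂ)) * (star U * V * Y)).trace := by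
      conv_lhs => rw [eq_mul_diagonal_mul hP, ← hU, Matrix.mul_assoc U, Matrix.mul_assoc U,
        Matrix.trace_mul_comm U]
      simp only [Matrix.mul_assoc, hUU, Matrix.mul_one]
    rw [this]
    simp [Matrix.trace, Matrix.diagonal_mul, Matrix.mul_apply (M := star U * V), Finset.mul_sum]
  have t2 : (Q * ((V * Y * star U) * (V * Y * star U).conjTranspose)).trace.re =
      ∑ i, ∑ j, hQ.eigenvalues j * Complex.normSq (Y j i) := by
    have : (Q * ((V * Y * star U) * (V * Y * star U).conjTranspose)).trace =
        (Matrix.diagonal (fun i => (hQ.eigenvalues i : ℂ)) * (Y * Y.conjTranspose)).trace := by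
      conv_lhs => rw [eq_mul_diagonal_mul hQ, ← hV, Matrix.mul_assoc V, Matrix.mul_assoc V,
        Matrix.trace_mul_comm V]
      simp only [Matrix.mul_assoc, star_mul, ← Matrix.star_eq_conjTranspose,
        star_star, c1, c2, hVV, Matrix.mul_one]
    rw [this, Finset.sum_comm]
    simp [Matrix.trace, Matrix.diagonal_mul, Matrix.mul_apply (M := Y), Finset.mul_sum,
      Complex.normSq_apply]
  have t3 : (P * ((V * Y * star U).conjTranspose * (V * Y * star U))).trace.re =
      ∑ i, ∑ j, hP.eigenvalues i * Complex.normSq (Y j i) := by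
    have : (P * ((V * Y * star U).conjTranspose * (V * Y * star U))).trace =
        (Matrix.diagonal (fun i => (hP.eigenvalues i : ℂ)) * (Y.conjTranspose * Y)).trace := by
      conv_lhs => rw [eq_mul_diagonal_mul hP, ← hU, Matrix.mul_assoc U, Matrix.mul_assoc U,
        Matrix.trace_mul_comm U]
      simp only [Matrix.mul_assoc, star_mul, ← Matrix.star_eq_conjTranspose,
        star_star, c1, c2, hUU, Matrix.mul_one]
    rw [this]
    simp [Matrix.trace, Matrix.diagonal_mul, Matrix.mul_apply (N := Y), Finset.mul_sum,
      Complex.normSq_apply]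
  rw [modularForm, t1, t2, t3]
  simp only [Finset.mul_sum, ← Finset.sum_sub_distrib]
  refine Finset.sum_congr rfl fun i _ => Finset.sum_congr rfl fun j _ => ?_
  ring

theorem modularForm_le (hP : P.PosSemidef) (hQ : Q.PosSemidef) {s : ℝ} (hs : 0 < s) (X : Op A) :
    modularForm P Q s X ≤ modularSum hP.1 hQ.1 s := by
  have hX : X = (hQ.1.eigenvectorUnitary : Op A) *
      (star (hQ.1.eigenvectorUnitary : Op A) * X * (hP.1.eigenvectorUnitary : Op A)) *
      star (hP.1.eigenvectorUnitary : Op A) := by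
    simp only [Matrix.mul_assoc]
    rw [← Matrix.mul_assoc]
    simp
  rw [hX, modularForm_mul_mul_star]
  generalize star (hQ.1.eigenvectorUnitary : Op A) * X * (hP.1.eigenvectorUnitary : Op A) = Y
  refine Finset.sum_le_sum fun i _ => Finset.sum_le_sum fun j _ => ?_
  rw [overlap]
  generalize (star (hP.1.eigenvectorUnitary : Op A) * (hQ.1.eigenvectorUnitary : Op A)) i j = w
  generalize Y j i = y
  have hp := hP.eigenvalues_nonneg i
  have hq := hQ.eigenvalues_nonneg j
  generalize hP.1.eigenvalues i = p at *
  generalize hQ.1.eigenvalues j = q at *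
  -- For `p = 0` the denominator may vanish; otherwise complete the square in `y`, whose optimum is
  -- `p * conj w / (q + s * p)`.
  rcases hp.eq_or_lt with rfl | hp
  · simpa using mul_nonneg hq (Complex.normSq_nonneg y)
  · have hd : 0 < q + s * p := by positivity
    rw [← mul_div_assoc, le_div_iff₀ hd]
    simp only [Complex.normSq_apply, Complex.mul_re]
    nlinarith [sq_nonneg ((q + s * p) * y.re - p * w.re), sq_nonneg ((q + s * p) * y.im + p * w.im)]

theorem exists_modularForm_eq (hP : P.PosSemidef) (hQ : Q.PosSemidef) {s : ℝ} (hs : 0 < s) :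
    ∃ X, modularForm P Q s X = modularSum hP.1 hQ.1 s := by
  refine ⟨_, (modularForm_mul_mul_star hP.1 hQ.1 s (Matrix.of fun j i =>
    ((hP.1.eigenvalues i / (hQ.1.eigenvalues j + s * hP.1.eigenvalues i) : ℝ) : ℂ) *
      star ((star (hP.1.eigenvectorUnitary : Op A) * (hQ.1.eigenvectorUnitary : Op A)) i j))).trans ?_⟩
  refine Finset.sum_congr rfl fun i _ => Finset.sum_congr rfl fun j _ => ?_
  rw [overlap, Matrix.of_apply]
  generalize (star (hP.1.eigenvectorUnitary : Op A) * (hQ.1.eigenvectorUnitary : Op A)) i j = w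
  have hp := hP.eigenvalues_nonneg i
  have hq := hQ.eigenvalues_nonneg j
  generalize hP.1.eigenvalues i = p at *
  generalize hQ.1.eigenvalues j = q at *
  rcases hp.eq_or_lt with rfl | hp
  · simp
  · have hd : 0 < q + s * p := by positivity
    simp only [Complex.normSq_apply, Complex.mul_re, Complex.mul_im, Complex.ofReal_re,
      Complex.ofReal_im, Complex.star_def, Complex.conj_re, Complex.conj_im]
    field_simp
    ring

end Overlap


/-! ### Relative entropy as an integral over resolvents -/

/-- The value of `relEntropy` when it is finite. -/
def realRelEntropy {A : Type} [Fintype A] [DecidableEq A] (P Q : Op A) : ℝ :=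
  (P * (cfc Real.log P - cfc Real.log Q)).trace.re

section Primitive

variable {A : Type} [Fintype A] [DecidableEq A] {P Q : Op A}

/-- A primitive of `modularSum`. -/
def modularPrimitive (hP : P.IsHermitian) (hQ : Q.IsHermitian) (T : ℝ) : ℝ :=
  ∑ i, ∑ j, overlap hP hQ i j * hP.eigenvalues i *
    (Real.log (hQ.eigenvalues j + T * hP.eigenvalues i) - Real.log (hQ.eigenvalues j))

/-- The `j`-th eigenvector of `Q` lies in `ker Q ⊆ ker P`. This removes the terms with `q = 0`, for
which `modularPrimitive` could fail to be continuous at `0`. -/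
theorem overlap_mul_eigenvalues_eq_zero (hP : P.IsHermitian) (hQ : Q.IsHermitian)
    (hker : ∀ v : A → ℂ, Q.mulVec v = 0 → P.mulVec v = 0) {i j : A}
    (hj : hQ.eigenvalues j = 0) : overlap hP hQ i j * hP.eigenvalues i = 0 := by
  have h1 : P.mulVec ((hQ.eigenvectorUnitary : Op A).col j) = 0 := by
    apply hker
    have := hQ.mulVec_eigenvectorBasis j
    rw [hj, zero_smul] at this
    rw [hQ.eigenvectorUnitary_col_eq]
    exact this
  have h2 : Matrix.diagonal (fun i => (hP.eigenvalues i : ℂ)) *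
      (star (hP.eigenvectorUnitary : Op A) * (hQ.eigenvectorUnitary : Op A)) =
      star (hP.eigenvectorUnitary : Op A) * (P * (hQ.eigenvectorUnitary : Op A)) := by
    have h := congrArg (star (hP.eigenvectorUnitary : Op A) * · * (hQ.eigenvectorUnitary : Op A))
      (eq_mul_diagonal_mul hP)
    simp only [Matrix.mul_assoc] at h
    rw [h, ← Matrix.mul_assoc (star _) (hP.eigenvectorUnitary : Op A)]
    simp
  have h3 : ∀ k, (P * (hQ.eigenvectorUnitary : Op A)) k j = 0 := fun k => congrFun h1 k
  have h4 := congrFun (congrFun h2 i) j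
  rw [Matrix.diagonal_mul, Matrix.mul_apply (N := P * _)] at h4
  simp only [h3, mul_zero, Finset.sum_const_zero, mul_eq_zero, Complex.ofReal_eq_zero] at h4
  rcases h4 with h4 | h4
  · rw [h4, mul_zero]
  · rw [overlap, h4, map_zero, zero_mul]

theorem hasDerivAt_modularPrimitive (hP : P.PosSemidef) (hQ : Q.PosSemidef) {T : ℝ} (hT : 0 < T) :
    HasDerivAt (modularPrimitive hP.1 hQ.1) (modularSum hP.1 hQ.1 T) T := by
  refine HasDerivAt.fun_sum fun i _ => HasDerivAt.fun_sum fun j _ => ?_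
  refine HasDerivAt.const_mul _ ?_
  have hp := hP.eigenvalues_nonneg i
  have hq := hQ.eigenvalues_nonneg j
  generalize hP.1.eigenvalues i = p at *
  generalize hQ.1.eigenvalues j = q at *
  rcases hp.eq_or_lt with rfl | hp
  · simpa using hasDerivAt_const T (0 : ℝ)
  · have hd : q + T * p ≠ 0 := by positivity
    have := (((hasDerivAt_id T).mul_const p).const_add q).log hd
    simpa using this.sub_const (Real.log q)

theorem continuousOn_modularPrimitive (hP : P.PosSemidef) (hQ : Q.PosSemidef)
    (hker : ∀ v : A → ℂ, Q.mulVec v = 0 → P.mulVec v = 0) :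
    ContinuousOn (modularPrimitive hP.1 hQ.1) (Set.Ici 0) := by
  refine continuousOn_finsetSum _ fun i _ => continuousOn_finsetSum _ fun j _ => ?_
  rcases (hQ.eigenvalues_nonneg j).eq_or_lt with hq | hq
  · simp only [overlap_mul_eigenvalues_eq_zero hP.1 hQ.1 hker hq.symm, zero_mul]
    exact continuousOn_const
  · refine continuousOn_const.mul (ContinuousOn.sub (ContinuousOn.log (by fun_prop) ?_)
      continuousOn_const)
    intro T hT
    have := mul_nonneg (Set.mem_Ici.1 hT) (hP.eigenvalues_nonneg i)
    positivity

theorem modularPrimitive_zero (hP : P.IsHermitian) (hQ : Q.IsHermitian) :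
    modularPrimitive hP hQ 0 = 0 := by
  simp [modularPrimitive]

/-- Termwise `log (q + T p) - log T = log (q / T + p) → log p` for `p > 0`; as the overlaps in each
row sum to `1`, the subtracted logarithms have total weight `tr P`. -/
theorem tendsto_modularPrimitive (hP : P.PosSemidef) (hQ : Q.PosSemidef) :
    Filter.Tendsto (fun T => modularPrimitive hP.1 hQ.1 T - P.trace.re * Real.log T) Filter.atTop
      (𝓝 (realRelEntropy P Q)) := by
  have htr : P.trace.re = ∑ i, ∑ j, overlap hP.1 hQ.1 i j * hP.1.eigenvalues i := by
    rw [hP.1.trace_eq_sum_eigenvalues]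
    simp [← Finset.sum_mul, sum_overlap]
  rw [realRelEntropy, trace_mul_log_sub_log hP.1 hQ.1]
  simp only [htr, modularPrimitive, Finset.sum_mul, ← Finset.sum_sub_distrib, ← mul_sub]
  refine tendsto_finsetSum _ fun i _ => tendsto_finsetSum _ fun j _ => ?_
  have hp := hP.eigenvalues_nonneg i
  have hq := hQ.eigenvalues_nonneg j
  generalize hP.1.eigenvalues i = p at *
  generalize hQ.1.eigenvalues j = q at *
  rcases hp.eq_or_lt with rfl | hp
  · simp
  · refine Filter.Tendsto.const_mul _ ?_
    have h1 : Filter.Tendsto (fun T : ℝ => Real.log (q * T⁻¹ + p) - Real.log q) Filter.atTop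
        (𝓝 (Real.log (q * 0 + p) - Real.log q)) := by
      refine Filter.Tendsto.sub_const (Filter.Tendsto.log ?_ (by simpa using hp.ne')) _
      exact (tendsto_inv_atTop_zero.const_mul q).add_const p
    rw [mul_zero, zero_add] at h1
    refine h1.congr' ?_
    filter_upwards [Filter.eventually_gt_atTop 0] with T hT
    have : q * T⁻¹ + p = (q + T * p) / T := by field_simp
    rw [this, Real.log_div (by positivity) hT.ne']
    ring

end Primitive

/-- The difference `H` of the primitives vanishes at `0` and has nonnegative derivative. By the
trace condition the `log T` divergences cancel, so its limit is the difference of the entropies. -/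
theorem realRelEntropy_le_of_modularSum_le {S A ι : Type} [Fintype S] [DecidableEq S] [Fintype A]
    [DecidableEq A] [Fintype ι] {P Q : Op S} (hP : P.PosSemidef) (hQ : Q.PosSemidef)
    {E F : ι → Op A} (hE : ∀ a, (E a).PosSemidef) (hF : ∀ a, (F a).PosSemidef) (r : ι → ℝ)
    (hPQ : ∀ v : S → ℂ, Q.mulVec v = 0 → P.mulVec v = 0)
    (hEF : ∀ a, ∀ v : A → ℂ, (F a).mulVec v = 0 → (E a).mulVec v = 0)
    (htr : P.trace.re = ∑ a, r a * (E a).trace.re)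
    (h : ∀ s, 0 < s → modularSum hP.1 hQ.1 s ≤ ∑ a, r a * modularSum (hE a).1 (hF a).1 s) :
    realRelEntropy P Q ≤ ∑ a, r a * realRelEntropy (E a) (F a) := by
  let H : ℝ → ℝ := fun T =>
    ∑ a, r a * modularPrimitive (hE a).1 (hF a).1 T - modularPrimitive hP.1 hQ.1 T
  have hd : ∀ T, 0 < T → HasDerivAt H
      (∑ a, r a * modularSum (hE a).1 (hF a).1 T - modularSum hP.1 hQ.1 T) T := fun T hT =>
    (HasDerivAt.fun_sum fun a _ =>
      (hasDerivAt_modularPrimitive (hE a) (hF a) hT).const_mul (r a)).sub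
      (hasDerivAt_modularPrimitive hP hQ hT)
  have hmono : MonotoneOn H (Set.Ici 0) := by
    refine monotoneOn_of_deriv_nonneg (convex_Ici 0) ?_ ?_ ?_
    · exact (continuousOn_finsetSum _ fun a _ => continuousOn_const.mul
        (continuousOn_modularPrimitive (hE a) (hF a) (hEF a))).sub
        (continuousOn_modularPrimitive hP hQ hPQ)
    · rw [interior_Ici]
      exact fun T hT => (hd T hT).differentiableAt.differentiableWithinAt
    · rw [interior_Ici]
      intro T hT
      rw [(hd T hT).deriv]
      exact sub_nonneg.2 (h T hT)
  have hnonneg : ∀ T, 0 ≤ T → 0 ≤ H T := by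
    intro T hT
    have h0 : H 0 = 0 := by simp [H, modularPrimitive_zero]
    rw [← h0]
    exact hmono Set.self_mem_Ici hT hT
  have hlim : Filter.Tendsto H Filter.atTop
      (𝓝 (∑ a, r a * realRelEntropy (E a) (F a) - realRelEntropy P Q)) := by
    refine ((tendsto_finsetSum Finset.univ fun a _ =>
      (tendsto_modularPrimitive (hE a) (hF a)).const_mul (r a)).sub
      (tendsto_modularPrimitive hP hQ)).congr fun T => ?_
    simp only [H, htr, mul_sub, Finset.sum_sub_distrib, Finset.sum_mul, mul_assoc]
    ring
  refine sub_nonneg.1 (ge_of_tendsto hlim ?_)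
  filter_upwards [Filter.eventually_ge_atTop 0] with T hT using hnonneg T hT

/-! ### Monotonicity and joint convexity of the relative entropy -/

theorem trace_mul_eq_zero {A : Type} [Fintype A] {E F Y : Op A} (hF : F.PosSemidef)
    (hEF : ∀ v : A → ℂ, F.mulVec v = 0 → E.mulVec v = 0) (hY : Y.PosSemidef)
    (h : (F * Y).trace = 0) : (E * Y).trace = 0 := by
  obtain ⟨m, u, rfl⟩ := Matrix.posSemidef_iff_eq_sum_vecMulVec.1 hY
  simp only [Matrix.mul_sum, Matrix.trace_sum, Matrix.mul_vecMulVec, Matrix.trace_vecMulVec] at h ⊢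
  simp only [dotProduct_comm _ (star _)] at h
  rw [Finset.sum_eq_zero_iff_of_nonneg fun i _ => hF.dotProduct_mulVec_nonneg _] at h
  refine Finset.sum_eq_zero fun i hi => ?_
  rw [hEF _ ((hF.dotProduct_mulVec_zero_iff _).1 (h i hi)), zero_dotProduct]

/-- Test on `v v*`: a sum of nonnegative terms `tr (F a * Θ a (v v*))` vanishes, so each does, and
the kernel condition carries this over to `E a`. -/
theorem mulVec_eq_zero_of_trace_eq {S A ι : Type} [Fintype S] [Fintype A] [Fintype ι]
    {P Q : Op S} {E F : ι → Op A} {Θ : ι → SOp S A} (hP : P.PosSemidef)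
    (hF : ∀ a, (F a).PosSemidef) (hΘ : ∀ a, IsCP (Θ a))
    (hEF : ∀ a, ∀ v : A → ℂ, (F a).mulVec v = 0 → (E a).mulVec v = 0)
    (hPE : ∀ X, (P * X).trace = ∑ a, (E a * Θ a X).trace)
    (hQF : ∀ X, (Q * X).trace = ∑ a, (F a * Θ a X).trace) {v : S → ℂ} (hv : Q.mulVec v = 0) :
    P.mulVec v = 0 := by
  rw [← hP.dotProduct_mulVec_zero_iff, dotProduct_comm, ← Matrix.trace_vecMulVec,
    ← Matrix.mul_vecMulVec, hPE]
  have h0 : (Q * Matrix.vecMulVec v (star v)).trace = 0 := by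
    rw [Matrix.mul_vecMulVec, hv]
    simp
  have hΘv : ∀ a, (Θ a (Matrix.vecMulVec v (star v))).PosSemidef := fun a =>
    (hΘ a).posSemidef (Matrix.posSemidef_vecMulVec_self_star v)
  rw [hQF, Finset.sum_eq_zero_iff_of_nonneg fun a _ => trace_mul_nonneg (hF a) (hΘv a)] at h0
  exact Finset.sum_eq_zero fun a ha => trace_mul_eq_zero (hF a) (hEF a) (hΘv a) (h0 a ha)

section Monotone

variable {S A ι : Type} [Fintype S] [DecidableEq S] [Fintype A] [DecidableEq A] [Fintype ι]
  {P Q : Op S} {E F : ι → Op A} {Θ : ι → SOp S A} {r : ι → ℝ}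

theorem modularSum_le_sum (hP : P.PosSemidef) (hQ : Q.PosSemidef)
    (hE : ∀ a, (E a).PosSemidef) (hF : ∀ a, (F a).PosSemidef) (hΘ : ∀ a, IsCP (Θ a))
    (hr : ∀ a, 0 ≤ r a) (h1 : ∀ a, Θ a 1 = (r a : ℂ) • 1)
    (hPE : ∀ X, (P * X).trace = ∑ a, (E a * Θ a X).trace)
    (hQF : ∀ X, (Q * X).trace = ∑ a, (F a * Θ a X).trace) {s : ℝ} (hs : 0 < s) :
    modularSum hP.1 hQ.1 s ≤ ∑ a, r a * modularSum (hE a).1 (hF a).1 s := by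
  obtain ⟨X, hX⟩ := exists_modularForm_eq hP hQ hs
  rw [← hX, modularForm, hPE, hPE, hQF]
  simp only [Complex.re_sum, Finset.mul_sum, ← Finset.sum_sub_distrib]
  refine Finset.sum_le_sum fun a _ => ?_
  -- With `X` optimal for `P` and `Q`, the trial point for `E a` and `F a` is `(r a)⁻¹ • Θ a X`; the
  -- Schwarz inequality for `X` and for `X*` controls the two quadratic terms.
  refine le_trans ?_ (mul_le_mul_of_nonneg_left (modularForm_le (hE a) (hF a) hs
    (((r a)⁻¹ : ℂ) • Θ a X)) (hr a))
  have k1 := trace_mul_nonneg (hF a) ((hΘ a).schwarz (hr a) (h1 a) X)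
  have k2 := trace_mul_nonneg (hE a) ((hΘ a).schwarz (hr a) (h1 a) X.conjTranspose)
  rw [(hΘ a).map_conjTranspose, Matrix.conjTranspose_conjTranspose,
    Matrix.conjTranspose_conjTranspose] at k2
  have k3 : (r a)⁻¹ * r a * (E a * Θ a X).trace.re = (E a * Θ a X).trace.re := by
    rcases eq_or_ne (r a) 0 with h0 | h0
    · rw [(hΘ a).map_eq_zero_of_map_one (by rw [h1 a, h0]; simp) X]
      simp
    · rw [inv_mul_cancel₀ h0, one_mul]
  have k4 : r a * ((r a)⁻¹ * (r a)⁻¹) = (r a)⁻¹ := by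
    rcases eq_or_ne (r a) 0 with h0 | h0
    · simp [h0]
    · field_simp
  rw [Matrix.mul_sub, Matrix.trace_sub, Matrix.mul_smul, Matrix.trace_smul, sub_nonneg] at k1 k2
  have k1 := (Complex.le_def.1 k1).1
  have k2 := (Complex.le_def.1 k2).1
  simp only [smul_eq_mul, ← Complex.ofReal_inv, Complex.re_ofReal_mul] at k1 k2
  have k2 := mul_le_mul_of_nonneg_left k2 hs.le
  simp only [modularForm, ← Complex.ofReal_inv, Matrix.conjTranspose_smul, Matrix.mul_smul,
    Matrix.smul_mul, Matrix.trace_smul, smul_eq_mul, Complex.star_def, Complex.conj_ofReal,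
    Complex.re_ofReal_mul]
  linear_combination k1 + k2 - 2 * k3 + (F a * (Θ a X * (Θ a X).conjTranspose)).trace.re * k4
    + s * (E a * ((Θ a X).conjTranspose * Θ a X)).trace.re * k4

/-- Joint monotonicity: the relative entropy does not increase under the adjoints of completely
positive maps `Θ a` that multiply the identity by `r a`, up to the weights `r a`. -/
theorem realRelEntropy_le_sum (hP : P.PosSemidef) (hQ : Q.PosSemidef)
    (hE : ∀ a, (E a).PosSemidef) (hF : ∀ a, (F a).PosSemidef) (hΘ : ∀ a, IsCP (Θ a))
    (hr : ∀ a, 0 ≤ r a) (h1 : ∀ a, Θ a 1 = (r a : ℂ) • 1)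
    (hEF : ∀ a, ∀ v : A → ℂ, (F a).mulVec v = 0 → (E a).mulVec v = 0)
    (hPE : ∀ X, (P * X).trace = ∑ a, (E a * Θ a X).trace)
    (hQF : ∀ X, (Q * X).trace = ∑ a, (F a * Θ a X).trace) :
    realRelEntropy P Q ≤ ∑ a, r a * realRelEntropy (E a) (F a) := by
  refine realRelEntropy_le_of_modularSum_le hP hQ hE hF r
    (fun v hv => mulVec_eq_zero_of_trace_eq hP hF hΘ hEF hPE hQF hv) hEF ?_
    fun s hs => modularSum_le_sum hP hQ hE hF hΘ hr h1 hPE hQF hs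
  have := congrArg Complex.re (hPE 1)
  simpa [h1] using this

end Monotone

/-! ### Extended real values -/

theorem relEntropy_ne_bot {A : Type} [Fintype A] [DecidableEq A] (P Q : Op A) :
    relEntropy P Q ≠ ⊥ := by
  rw [relEntropy]
  split_ifs
  exacts [EReal.coe_ne_bot _, top_ne_bot]

theorem relEntropy_eq_coe {A : Type} [Fintype A] [DecidableEq A] {P Q : Op A}
    (h : ∀ v : A → ℂ, Q.mulVec v = 0 → P.mulVec v = 0) :
    relEntropy P Q = (realRelEntropy P Q : ℝ) := if_pos h

theorem relEntropy_eq_top {A : Type} [Fintype A] [DecidableEq A] {P Q : Op A}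
    (h : ¬ ∀ v : A → ℂ, Q.mulVec v = 0 → P.mulVec v = 0) : relEntropy P Q = ⊤ := if_neg h

theorem ereal_sum_eq_top {ι : Type} [Fintype ι] {f : ι → EReal} (hbot : ∀ i, f i ≠ ⊥) {i : ι}
    (hi : f i = ⊤) : ∑ i, f i = ⊤ := by
  classical
  rw [← Finset.add_sum_erase _ _ (Finset.mem_univ i), hi]
  refine EReal.top_add_of_ne_bot ?_
  refine Finset.sum_induction f (· ≠ ⊥) (fun a b ha hb => ?_) EReal.zero_ne_bot fun i _ => hbot i
  simp [EReal.add_eq_bot_iff, ha, hb]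

/-- Monotonicity of the relative entropy under the adjoint of a unital completely positive map. -/
theorem relEntropy_le_of_trace_eq {S A : Type} [Fintype S] [DecidableEq S] [Fintype A]
    [DecidableEq A] {P Q : Op S} {E F : Op A} {Θ : SOp S A} (hP : P.PosSemidef) (hQ : Q.PosSemidef)
    (hE : E.PosSemidef) (hF : F.PosSemidef) (hΘ : IsCP Θ) (h1 : Θ 1 = 1)
    (hPE : ∀ X, (P * X).trace = (E * Θ X).trace) (hQF : ∀ X, (Q * X).trace = (F * Θ X).trace) :
    relEntropy P Q ≤ relEntropy E F := by
  by_cases h : ∀ v : A → ℂ, F.mulVec v = 0 → E.mulVec v = 0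
  · have hPE' : ∀ X, (P * X).trace = ∑ _a : Unit, (E * Θ X).trace := by simpa using hPE
    have hQF' : ∀ X, (Q * X).trace = ∑ _a : Unit, (F * Θ X).trace := by simpa using hQF
    rw [relEntropy_eq_coe h, relEntropy_eq_coe fun v hv => mulVec_eq_zero_of_trace_eq hP
      (fun _ => hF) (fun _ => hΘ) (fun _ => h) hPE' hQF' hv]
    have := realRelEntropy_le_sum (r := fun _ => 1) hP hQ (fun _ => hE) (fun _ => hF)
      (fun _ => hΘ) (fun _ => zero_le_one) (by simpa using h1) (fun _ => h) hPE' hQF'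
    simpa using this
  · rw [relEntropy_eq_top h]
    exact le_top


/-! ### Weighted partial traces -/

/-- The map `Y ↦ tr_U ((1 ⊗ N) Y)`. -/
def weightedTrace {A U : Type} [Fintype U] (N : Op U) : SOp (A × U) A where
  toFun Y := ∑ u, ∑ v, N u v • Y.submatrix (·, v) (·, u)
  map_add' X Y := by
    ext i j
    simp [Matrix.sum_apply, mul_add, Finset.sum_add_distrib]
  map_smul' c X := by
    ext i j
    simp [Matrix.sum_apply, Finset.mul_sum, mul_left_comm c]

theorem weightedTrace_apply {A U : Type} [Fintype U] (N : Op U) (Y : Op (A × U)) :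
    weightedTrace N Y = ∑ u, ∑ v, N u v • Y.submatrix (·, v) (·, u) := rfl

/-- Decomposing `N` into rank-one terms `w w*` gives the Kraus operators `1 ⊗ w*`. -/
theorem isCP_weightedTrace {A U : Type} [Fintype A] [Fintype U] {N : Op U} (hN : N.PosSemidef) :
    IsCP (weightedTrace (A := A) N) := by
  classical
  obtain ⟨m, w, rfl⟩ := Matrix.posSemidef_iff_eq_sum_vecMulVec.1 hN
  let V : Fin m → Matrix A (A × U) ℂ := fun k =>
    Matrix.of fun i p => if p.1 = i then star (w k p.2) else 0
  have : weightedTrace (A := A) (∑ k, Matrix.vecMulVec (w k) (star (w k))) = ∑ k, conj (V k) := by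
    ext1 Y
    ext i j
    rw [weightedTrace_apply, LinearMap.sum_apply]
    simp only [Matrix.sum_apply, Matrix.smul_apply, Matrix.submatrix_apply, smul_eq_mul,
      Finset.sum_mul]
    have hV : ∀ k, conj (V k) Y i j = ∑ u, ∑ v, w k u * star (w k v) * Y (i, v) (j, u) := by
      intro k
      simp only [conj_apply, Matrix.mul_apply, V, Matrix.conjTranspose_apply, Matrix.of_apply,
        Fintype.sum_prod_type, ite_mul, zero_mul, apply_ite star, star_star, star_zero, mul_ite,
        mul_zero]
      rw [Finset.sum_comm]
      simp only [Finset.sum_ite_irrel, Finset.sum_const_zero, Finset.sum_ite_eq', Finset.mem_univ,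
        if_true, Finset.sum_mul]
      refine Finset.sum_congr rfl fun u _ => Finset.sum_congr rfl fun v _ => ?_
      ring
    simp only [hV, Matrix.vecMulVec_apply, Pi.star_apply]
    rw [Finset.sum_comm (s := (Finset.univ : Finset (Fin m)))]
    exact Finset.sum_congr rfl fun u _ => Finset.sum_comm
  rw [this]
  exact IsCP.sum _ fun k => isCP_conj _

theorem weightedTrace_one {A U : Type} [Fintype U] [DecidableEq A] [DecidableEq U] (N : Op U) :
    weightedTrace N (1 : Op (A × U)) = N.trace • 1 := by
  have h : ∀ u v : U, (1 : Op (A × U)).submatrix (·, v) (·, u) = if u = v then 1 else 0 := by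
    intro u v
    ext i j
    by_cases huv : u = v
    · simp [huv, Matrix.one_apply]
    · simp [huv, Ne.symm huv]
  simp [weightedTrace_apply, h, Matrix.trace, Finset.sum_smul]

/-- As `N` is block diagonal in the `A`-label, only the entries `⟨a|E(Z)|a⟩ = tr (E†|a⟩⟨a| * Z)` of
the output of `E` contribute. -/
theorem trace_mul_ampL_ampL {A B R : Type} [Fintype A] [DecidableEq A] [Fintype B] [Fintype R]
    {N : Op ((A × B) × R)} (hN : ∀ p q, p.1.1 ≠ q.1.1 → N p q = 0) (E : SOp A A)
    (Y : Op ((A × B) × R)) :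
    (N * ampL R (ampL B E) Y).trace = ∑ a, (dual E (Matrix.single a a 1) *
      weightedTrace (N.submatrix (fun u : B × R => ((a, u.1), u.2)) fun u => ((a, u.1), u.2))
        (relabel (Equiv.prodAssoc A B R) Y)).trace := by
  have h1 : ∀ (a : A) (Z : Op A), (dual E (Matrix.single a a 1) * Z).trace = E Z a a := by
    intro a Z
    rw [trace_dual_mul, Matrix.trace_single_mul, one_smul]
  simp only [h1, weightedTrace_apply, map_sum, map_smul, Matrix.sum_apply, Matrix.smul_apply,
    smul_eq_mul]
  simp only [Matrix.trace, Matrix.diag, Matrix.mul_apply]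
  rw [← (Equiv.prodAssoc A B R).symm.sum_comp, Fintype.sum_prod_type]
  refine Finset.sum_congr rfl fun a _ => Finset.sum_congr rfl fun u _ => ?_
  rw [← (Equiv.prodAssoc A B R).symm.sum_comp, Fintype.sum_prod_type]
  rw [Finset.sum_eq_single a]
  · rfl
  · intro b _ hb
    exact Finset.sum_eq_zero fun v _ => by rw [hN _ _ (Ne.symm hb), zero_mul]
  · simp

/-! ### Measurements after dephasing -/

/-- Detection-incoherence puts a dephasing in front of `K`, and it annihilates matrix units between
different labels. -/
theorem dual_ampL_dephase_apply_eq_zero {A R S : Type} [Fintype A] [DecidableEq A] [Fintype R]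
    [DecidableEq R] [Fintype S] {K : SOp A A} (hK : IsDIO K) (Φ : SOp (A × R) S) (M : Op S)
    {p q : A × R} (hpq : p.1 ≠ q.1) :
    dual (Φ ∘ₗ ampL R (dephase A ∘ₗ K)) M p q = 0 := by
  have h : ampL R (dephase A ∘ₗ K) (Matrix.single q p 1) = 0 := by
    rw [hK.2]
    ext i j
    have h0 : dephase A (Matrix.of fun k l => Matrix.single q p (1 : ℂ) (k, i.2) (l, j.2)) = 0 := by
      ext k l
      simp only [dephase_apply, Matrix.of_apply, Matrix.single_apply]
      split_ifs with h1 h2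
      · exact absurd ((congrArg Prod.fst h2.2).trans (congrArg Prod.fst h2.1).symm) hpq
      · rfl
      · rfl
    simp [ampL, h0]
  simp [dual, h]

theorem relabel_one {A C : Type} [DecidableEq A] [DecidableEq C] (e : A ≃ C) :
    relabel e 1 = 1 := by
  ext i j
  simp [relabel, Matrix.one_apply]

theorem IsUnital.ampL {A C : Type} (R : Type) [DecidableEq A] [DecidableEq C] [DecidableEq R]
    {Φ : SOp A C} (h : IsUnital Φ) : IsUnital (ampL R Φ) := by
  ext p q
  have h1 : (Matrix.of fun i k => (1 : Op (A × R)) (i, p.2) (k, q.2)) =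
      if p.2 = q.2 then 1 else 0 := by
    ext i k
    by_cases hpq : p.2 = q.2 <;> simp [hpq, Matrix.one_apply]
  rw [IsUnital] at h
  simp only [QMeas.ampL, LinearMap.coe_mk, AddHom.coe_mk, Matrix.of_apply, h1]
  by_cases hpq : p.2 = q.2 <;> simp [h, hpq, Matrix.one_apply, Prod.ext_iff]

theorem posSemidef_single {A : Type} [DecidableEq A] (a : A) :
    (Matrix.single a a (1 : ℂ)).PosSemidef := by
  rw [← Matrix.diagonal_single]
  exact Matrix.PosSemidef.diagonal (Pi.single_nonneg.2 zero_le_one)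

theorem ereal_coe_mul_sum {ι : Type} [Fintype ι] (c : ℝ) (f : ι → ℝ) :
    (c : EReal) * ∑ a, (f a : EReal) = ((c * ∑ a, f a : ℝ) : EReal) := by
  rw [EReal.coe_mul]
  exact congrArg _ (map_sum (⟨⟨Real.toEReal, EReal.coe_zero⟩, EReal.coe_add⟩ : ℝ →+ EReal) f _).symm

/-- The relative entropies of the POVM elements `E† |a⟩⟨a|` bound those of every measurement that
is preceded by dephasing and detection-incoherent operations. -/
theorem measRelEntropy_extend_le {A B : Type} [Fintype A] [DecidableEq A] [Nonempty A] [Fintype B]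
    [DecidableEq B] [Nonempty B] {E F : SOp A A} (hE : IsChannel E) (hF : IsChannel F)
    {K L : SOp (A × B) (A × B)} (hK : IsDIO K) (hL : IsChannel L) (hL1 : IsUnital L) {k l n : ℕ}
    (hk : 0 < k) (hl : 0 < l) {M : Fin n → Op ((A × Fin k) × (B × Fin l))} (hM : IsPOVM M) :
    measRelEntropy (preComp M (extend (Fin k) (Fin l) (dephase (A × B) ∘ₗ K ∘ₗ ampL B E ∘ₗ L)))
      (preComp M (extend (Fin k) (Fin l) (dephase (A × B) ∘ₗ K ∘ₗ ampL B F ∘ₗ L))) ≤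
      (((Fintype.card A : ℝ)⁻¹ : ℝ) : EReal) *
        ∑ a, relEntropy (dual E (Matrix.single a a 1)) (dual F (Matrix.single a a 1)) := by
  have hEa := fun a => dual_posSemidef hE.1 (posSemidef_single a)
  have hFa := fun a => dual_posSemidef hF.1 (posSemidef_single a)
  by_cases hker : ∀ a, ∀ v : A → ℂ, (dual F (Matrix.single a a 1)).mulVec v = 0 →
    (dual E (Matrix.single a a 1)).mulVec v = 0
  swap
  -- If the kernel condition fails for some `a`, the right-hand side is `+∞`.
  · push Not at hker
    obtain ⟨a, ha⟩ := hker
    rw [ereal_sum_eq_top (fun _ => relEntropy_ne_bot _ _) (relEntropy_eq_top (by push Not; exact ha)),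
      EReal.coe_mul_top_of_pos (by positivity)]
    exact le_top
  let R := Fin k × Fin l
  let S := (A × Fin k) × (B × Fin l)
  -- `Λ` collects everything after `E`, and `Γ` below everything before it.
  let Λ : SOp ((A × B) × R) S := relabel (Equiv.prodProdProdComm A B (Fin k) (Fin l)) ∘ₗ
    ampL R (dephase (A × B) ∘ₗ K)
  have hΛ : IsChannel Λ := ⟨(isCP_relabel _).comp (((isCP_dephase _).comp hK.1.1).ampL R),
    (isTP_relabel _).comp (((isTP_dephase _).comp hK.1.2).ampL R)⟩
  let N : Fin n → Op ((A × B) × R) := fun x => dual Λ (M x)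
  have hN : IsPOVM N := hM.dual hΛ
  let Na : Fin n → A → Op (B × R) := fun x a =>
    (N x).submatrix (fun u => ((a, u.1), u.2)) fun u => ((a, u.1), u.2)
  have hNa : ∀ x a, (Na x a).PosSemidef := fun x a => (hN.1 x).submatrix _
  let Γ : SOp S (A × (B × R)) := relabel (Equiv.prodAssoc A B R) ∘ₗ ampL R L ∘ₗ
    relabel (Equiv.prodProdProdComm A (Fin k) B (Fin l))
  have hΓ : IsCP Γ := (isCP_relabel _).comp ((hL.1.ampL R).comp (isCP_relabel _))
  have hΓ1 : Γ 1 = 1 := by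
    simp only [Γ, LinearMap.comp_apply, relabel_one]
    rw [(hL1.ampL R : ampL R L 1 = 1), relabel_one]
  let Θ : Fin n → A → SOp S A := fun x a => weightedTrace (Na x a) ∘ₗ Γ
  have hΘ : ∀ x a, IsCP (Θ x a) := fun x a => (isCP_weightedTrace (hNa x a)).comp hΓ
  let r : Fin n → A → ℝ := fun x a => (Na x a).trace.re
  have hr : ∀ x a, ((r x a : ℝ) : ℂ) = (Na x a).trace := fun x a =>
    (Complex.eq_re_of_ofReal_le (r := 0) (by simpa using (hNa x a).trace_nonneg)).symm
  have hr0 : ∀ x a, 0 ≤ r x a := fun x a => (Complex.le_def.1 (hNa x a).trace_nonneg).1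
  have hΘ1 : ∀ x a, Θ x a 1 = (r x a : ℂ) • 1 := by
    intro x a
    rw [LinearMap.comp_apply, hΓ1, weightedTrace_one, hr]
  have hrsum : ∀ a, ∑ x, r x a = Fintype.card (B × R) := by
    intro a
    have h1 : ∑ x, Na x a = 1 := by
      ext u v
      have := congrFun (congrFun hN.2 ((a, u.1), u.2)) ((a, v.1), v.2)
      rw [Matrix.sum_apply] at this ⊢
      exact this.trans (by simp [Matrix.one_apply, Prod.ext_iff])
    have h2 := congrArg (fun X => (Matrix.trace X).re) h1
    simpa [Matrix.trace_sum] using h2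
  -- The maps `Θ x a` do not depend on `G`; hence both POVMs arise from the same maps, as joint
  -- monotonicity requires.
  have hpair : ∀ (G : SOp A A) (x : Fin n) (X : Op S),
      (dual (extend (Fin k) (Fin l) (dephase (A × B) ∘ₗ K ∘ₗ ampL B G ∘ₗ L)) (M x) * X).trace =
        ∑ a, (dual G (Matrix.single a a 1) * Θ x a X).trace := by
    intro G x X
    rw [trace_dual_mul]
    refine (trace_dual_mul Λ (M x) (ampL R (ampL B G) (ampL R L
      (relabel (Equiv.prodProdProdComm A (Fin k) B (Fin l)) X)))).symm.trans ?_
    exact trace_mul_ampL_ampL (fun p q hpq => dual_ampL_dephase_apply_eq_zero hK _ _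
      fun hc => hpq (congrArg Prod.fst hc)) G _
  have hch : ∀ {G : SOp A A}, IsChannel G →
      IsChannel (extend (Fin k) (Fin l) (dephase (A × B) ∘ₗ K ∘ₗ ampL B G ∘ₗ L)) := by
    intro G hG
    refine ⟨(isCP_relabel _).comp ((IsCP.ampL _ ?_).comp (isCP_relabel _)), IsTP.extend _ _ ?_⟩
    · exact (isCP_dephase _).comp (hK.1.1.comp ((hG.1.ampL B).comp hL.1))
    · exact (isTP_dephase _).comp (hK.1.2.comp ((hG.2.ampL B).comp hL.2))
  have hPx := (hM.dual (hch hE)).1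
  have hQx := (hM.dual (hch hF)).1
  have hx : ∀ x, relEntropy
      (dual (extend (Fin k) (Fin l) (dephase (A × B) ∘ₗ K ∘ₗ ampL B E ∘ₗ L)) (M x))
      (dual (extend (Fin k) (Fin l) (dephase (A × B) ∘ₗ K ∘ₗ ampL B F ∘ₗ L)) (M x)) ≤
      ((∑ a, r x a * realRelEntropy (dual E (Matrix.single a a 1))
        (dual F (Matrix.single a a 1)) : ℝ) : EReal) := by
    intro x
    rw [relEntropy_eq_coe fun v hv => mulVec_eq_zero_of_trace_eq (hPx x) hFa (hΘ x) hker
      (hpair E x) (hpair F x) hv]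
    exact EReal.coe_le_coe_iff.2 (realRelEntropy_le_sum (hPx x) (hQx x) hEa hFa (hΘ x) (hr0 x)
      (hΘ1 x) hker (hpair E x) (hpair F x))
  simp only [relEntropy_eq_coe (hker _)]
  rw [measRelEntropy]
  refine (mul_le_mul_of_nonneg_left (Finset.sum_le_sum fun x _ => hx x)
    (EReal.coe_nonneg.2 (by positivity))).trans ?_
  rw [ereal_coe_mul_sum, ereal_coe_mul_sum, Finset.sum_comm]
  simp only [← Finset.sum_mul, hrsum, ← Finset.mul_sum, ← mul_assoc]
  -- The weights for each `a` add up to `|B| k l`, which reduces the prefactor `1 / (|A| k |B| l)`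
  -- to `1 / |A|`.
  refine le_of_eq (congrArg (fun c : ℝ => ((c * _ : ℝ) : EReal)) ?_)
  simp only [R, Fintype.card_prod, Fintype.card_fin, Nat.cast_mul]
  have hA : (Fintype.card A : ℝ) ≠ 0 := by positivity
  have hB : (Fintype.card B : ℝ) ≠ 0 := by positivity
  field_simp

/-- The measurement in the incoherent basis, without an effective ancilla, is among the incoherent
measurements. -/
theorem sum_relEntropy_le {A : Type} [Fintype A] [DecidableEq A] {E F : SOp A A} (hE : IsChannel E)
    (hF : IsChannel F) :
    (((Fintype.card A : ℝ)⁻¹ : ℝ) : EReal) *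
        ∑ a, relEntropy (dual E (Matrix.single a a 1)) (dual F (Matrix.single a a 1)) ≤
      ⨆ (k : ℕ) (_ : 0 < k) (n : ℕ) (M : Fin n → Op (A × Fin k)) (_ : IsIncoherentMeas M),
        measRelEntropy (preComp M (ampL (Fin k) E)) (preComp M (ampL (Fin k) F)) := by
  let e := Fintype.equivFin A
  let M : Fin (Fintype.card A) → Op (A × Fin 1) := fun x =>
    Matrix.single (e.symm x, 0) (e.symm x, 0) 1
  have hM : IsIncoherentMeas M := by
    refine ⟨⟨fun x => posSemidef_single _, ?_⟩, fun x => ?_⟩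
    · rw [e.symm.sum_comp fun a => Matrix.single (a, (0 : Fin 1)) (a, 0) (1 : ℂ)]
      ext i j
      simp [Matrix.sum_apply, Matrix.single_apply, Matrix.one_apply, Prod.ext_iff, ite_and,
        eq_iff_true_of_subsingleton]
    · ext i j
      simp only [dephase_apply, M, Matrix.single_apply]
      grind
  refine le_trans ?_ (le_iSup_of_le 1 (le_iSup_of_le zero_lt_one
    (le_iSup_of_le (Fintype.card A) (le_iSup_of_le M (le_iSup_of_le hM le_rfl)))))
  rw [measRelEntropy, ← e.symm.sum_comp]
  simp only [Fintype.card_prod, Fintype.card_fin, mul_one]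
  refine mul_le_mul_of_nonneg_left (Finset.sum_le_sum fun x _ => ?_)
    (EReal.coe_nonneg.2 (by positivity))
  have hpair : ∀ (G : SOp A A) (X : Op A), (dual G (Matrix.single (e.symm x) (e.symm x) 1) * X).trace =
      (dual (ampL (Fin 1) G) (M x) * relabel (Equiv.prodUnique A (Fin 1)).symm X).trace := by
    intro G X
    rw [trace_dual_mul, trace_dual_mul, Matrix.trace_single_mul, Matrix.trace_single_mul]
    rfl
  -- The relabelling of `A` as `A × Fin 1` is unital and completely positive, so monotonicity
  -- transfers the entropies between the two index types.
  refine relEntropy_le_of_trace_eq (dual_posSemidef hE.1 (posSemidef_single _))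
    (dual_posSemidef hF.1 (posSemidef_single _))
    (dual_posSemidef (hE.1.ampL _) (hM.1.1 x)) (dual_posSemidef (hF.1.ampL _) (hM.1.1 x))
    (isCP_relabel (Equiv.prodUnique A (Fin 1)).symm) ?_ (hpair E) (hpair F)
  exact relabel_one _

end QMeas

end

/-! ### Comparison of the two powers -/

theorem theorem3 {A B : Type} [Fintype A] [DecidableEq A] [Nonempty A]
    [Fintype B] [DecidableEq B] [Nonempty B]
    (E : QMeas.SOp A A) (hE : QMeas.IsChannel E)
    (K : QMeas.SOp (A × B) (A × B)) (hK : QMeas.IsDIO K)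
    (L : QMeas.SOp (A × B) (A × B)) (hL : QMeas.IsDIO L) (hL1 : QMeas.IsUnital L) :
    QMeas.entPower (QMeas.dephase (A × B) ∘ₗ K ∘ₗ QMeas.ampL B E ∘ₗ L) ≤ QMeas.cohPower E := by
  refine le_iInf₂ fun F hF => ?_
  have hG : QMeas.IsLOCC (QMeas.dephase (A × B) ∘ₗ K ∘ₗ QMeas.ampL B F ∘ₗ L) := by
    refine QMeas.isLOCC_of_dephase_comp_comp_dephase
      ⟨(QMeas.isCP_dephase _).comp (hK.1.1.comp ((hF.1.1.ampL B).comp hL.1.1)),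
        (QMeas.isTP_dephase _).comp (hK.1.2.comp ((hF.1.2.ampL B).comp hL.1.2))⟩ ?_
    ext1 X
    have hd := fun Y => LinearMap.congr_fun (QMeas.dephase_comp_dephase (A := A × B)) Y
    have h1 := fun Y => LinearMap.congr_fun hK.2 Y
    have h2 := fun Y => LinearMap.congr_fun (hF.dephase_comp_ampL (B := B)) Y
    have h3 := fun Y => LinearMap.congr_fun hL.2 Y
    simp only [LinearMap.comp_apply] at *
    -- The output dephasing is pushed through `K` and `F` to `L`, where it absorbs the input
    -- dephasing; the inserted copies are then removed again.
    rw [hd, h1, h2, ← h3, ← h2, ← h1]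
  refine (iInf₂_le _ hG.isClosedLOCC).trans ?_
  refine iSup₂_le fun k hk => iSup₂_le fun l hl => iSup_le fun n => iSup₂_le fun M hM => ?_
  exact (QMeas.measRelEntropy_extend_le hE hF.1 hK hL.1 hL1 hk hl hM.isPOVM).trans
    (QMeas.sum_relEntropy_le hE hF.1)
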